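/- **Theorem 3.1.** Let $(\mathscr D^-,\mathscr D^+)$ be a random pair of non-negative integers with joint distribution $G$ such that, for some $0<\kappa\le 1$, $$E[|\mathscr D^--\mathscr D^+|^{1+\kappa}]<\infty,\qquad E[(\mathscr D^-)^{1+\kappa}(\mathscr D^+)^{1+\kappa}]<\infty,\qquad \nu:=E[\mathscr D^-]=E[\mathscr D^+]>0 .$$ Let $\delta=c\kappa/(1+\kappa)$ for some $0<c<1$ if $\kappa<1$, and let $0<\delta<1/2$ be arbitrary if $\kappa=1$. For $n\ge1$ consider the following algorithm. * Step 1. Sample i.i.d. pairs $(\mathscr D_i^-,\mathscr D_i^+)$, $1\le i\le n$, with distribution $G$. * Step 2. Let $\Delta_n=\sum_{i=1}^n(\mathscr D_i^--\mathscr D_i^+)$. If $|\Delta_n|\le n^{1-\delta}$, proceed to Step 3; otherwise repeat Step 1 with a fresh independent sample. * Step 3. Given the samples, select $|\Delta_n|$ of the indices $1,\dots,n$ uniformly at random without replacement, and set $D_i^-=\mathscr D_i^-+1(\Delta_n\le0,\ i\text{ selected})$ and $D_i^+=\mathscr D_i^++1(\Delta_n>0,\ i\text{ selected})$. Let $L_n=\sum_iD_i^-=\sum_iD_i^+$,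 and let $G_n^\pm$, $F_n^\pm$ be the distribution functions of the probability mass functions $$g_n^\pm(t)=\frac1n\sum_{r=1}^n1(D_r^\pm=t),\qquad f_n^\pm(t)=\frac1{L_n}\sum_{r=1}^n1(D_r^\pm=t)\,D_r^\mp,\qquad t=0,1,2,\dots$$ Let $G^\pm$ be the distribution of $\mathscr D^\pm$, let $F^\pm(x)=E[1(\mathscr D^\pm\le x)\,\mathscr D^\mp]/\nu$, and let $d_1(\mu,\mu')=\inf_\pi\int|x-y|\,d\pi(x,y)$, the infimum being over all couplings $\pi$ of $\mu$ and $\mu'$, be the Kantorovich–Rubinstein distance. Fix $0<\varepsilon<\delta$ and $K_\kappa<\infty$ with $$E\big[(\mathscr D^-)^{1+\kappa}\mathscr D^++\mathscr D^-(\mathscr D^+)^{1+\kappa}\big]<K_\kappa,$$ and let $\Omega_n$ be the event that the algorithm terminates and that its output satisfies both $$\max\{d_1(G_n^+,G^+),\,d_1(G_n^-,G^-),\,d_1(F_n^+,F^+),\,d_1(F_n^-,F^-)\}\le n^{-\varepsilon}$$ and $$\sum_{r=1}^n\big((D_r^-)^\kappa+(D_r^+)^\kappa\big)D_r^+D_r^-\le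 K_\kappa n .$$ Then $\lim_{n\to\infty}P(\Omega_n)=1$. -/

import Mathlib

open MeasureTheory ProbabilityTheory Filter Topology
open scoped ENNReal

noncomputable section

namespace IIDAlgorithm

/-! ### The Kantorovich–Rubinstein distance -/

/-- Joint probability measures on `ℝ × ℝ` with marginals `μ` and `ν`. -/
def couplings (μ ν : Measure ℝ) : Set (Measure (ℝ × ℝ)) :=
  {π | IsProbabilityMeasure π ∧ π.map Prod.fst = μ ∧ π.map Prod.snd = ν}

/-- The Kantorovich–Rubinstein distance, with values in `[0, ∞]`
(it is `∞` if there is no coupling at all). -/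
def d₁ (μ ν : Measure ℝ) : ℝ≥0∞ :=
  ⨅ π ∈ couplings μ ν, ∫⁻ z, ENNReal.ofReal |z.1 - z.2| ∂π

/-! ### Bi-degree sequences

A sequence of `n` pairs is `d : Fin n → ℕ × ℕ`; node `r` has in-degree `(d r).1` and
out-degree `(d r).2`. -/

/-- Total number of edges `L_n`; for a bi-degree sequence the out-degrees have the same sum. -/
def edges {n : ℕ} (d : Fin n → ℕ × ℕ) : ℕ := ∑ r, (d r).1

/-- `g_n^-`. -/
def gMinus {n : ℕ} (d : Fin n → ℕ × ℕ) (t : ℕ) : ℝ≥0∞ :=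
  (∑ r, if (d r).1 = t then 1 else 0) / (n : ℝ≥0∞)

/-- `g_n^+`. -/
def gPlus {n : ℕ} (d : Fin n → ℕ × ℕ) (t : ℕ) : ℝ≥0∞ :=
  (∑ r, if (d r).2 = t then 1 else 0) / (n : ℝ≥0∞)

/-- `f_n^-`. -/
def fMinus {n : ℕ} (d : Fin n → ℕ × ℕ) (t : ℕ) : ℝ≥0∞ :=
  (∑ r, if (d r).1 = t then ((d r).2 : ℝ≥0∞) else 0) / (edges d : ℝ≥0∞)

/-- `f_n^+`. -/
def fPlus {n : ℕ} (d : Fin n → ℕ × ℕ) (t : ℕ) : ℝ≥0∞ :=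
  (∑ r, if (d r).2 = t then ((d r).1 : ℝ≥0∞) else 0) / (edges d : ℝ≥0∞)

/-- The measure on `ℝ` with mass function `f` on the non-negative integers. -/
def ofMass (f : ℕ → ℝ≥0∞) : Measure ℝ :=
  Measure.sum fun t : ℕ => f t • Measure.dirac (t : ℝ)

/-! ### The limit laws of a joint law `G` of `(𝒟⁻, 𝒟⁺)` on `ℕ × ℕ` -/

/-- `ν = E[𝒟⁺]`. -/
def meanDegree (G : Measure (ℕ × ℕ)) : ℝ := ∫ p, (p.2 : ℝ) ∂G

/-- The law `G^-` of `𝒟⁻`. -/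
def limGMinus (G : Measure (ℕ × ℕ)) : Measure ℝ := G.map fun p => (p.1 : ℝ)

/-- The law `G^+` of `𝒟⁺`. -/
def limGPlus (G : Measure (ℕ × ℕ)) : Measure ℝ := G.map fun p => (p.2 : ℝ)

/-- The law `F^-`, with distribution function `x ↦ E[1(𝒟⁻ ≤ x) 𝒟⁺] / ν`. -/
def limFMinus (G : Measure (ℕ × ℕ)) : Measure ℝ :=
  (G.withDensity fun p => ENNReal.ofReal ((p.2 : ℝ) / meanDegree G)).map fun p => (p.1 : ℝ)

/-- The law `F^+`, with distribution function `x ↦ E[1(𝒟⁺ ≤ x) 𝒟⁻] / ν`. -/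
def limFPlus (G : Measure (ℕ × ℕ)) : Measure ℝ :=
  (G.withDensity fun p => ENNReal.ofReal ((p.1 : ℝ) / meanDegree G)).map fun p => (p.2 : ℝ)

/-- The property of the realized sequence that defines the event `Ω_n`: it is a bi-degree
sequence (equal total in- and out-degree), its four empirical laws are within `n^{-ε}` of
the limits, and `∑ ((D⁻)^κ + (D⁺)^κ) D⁺ D⁻ ≤ K n`. -/
def IsRegular (G : Measure (ℕ × ℕ)) (κ ε K : ℝ) {n : ℕ} (d : Fin n → ℕ × ℕ) : Prop :=
  ∑ r, (d r).1 = ∑ r, (d r).2 ∧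
  d₁ (ofMass (gPlus d)) (limGPlus G) ≤ ENNReal.ofReal ((n : ℝ) ^ (-ε)) ∧
  d₁ (ofMass (gMinus d)) (limGMinus G) ≤ ENNReal.ofReal ((n : ℝ) ^ (-ε)) ∧
  d₁ (ofMass (fPlus d)) (limFPlus G) ≤ ENNReal.ofReal ((n : ℝ) ^ (-ε)) ∧
  d₁ (ofMass (fMinus d)) (limFMinus G) ≤ ENNReal.ofReal ((n : ℝ) ^ (-ε)) ∧
  ∑ r, (((d r).1 : ℝ) ^ κ + ((d r).2 : ℝ) ^ κ) * ((d r).2 : ℝ) * ((d r).1 : ℝ) ≤ K * n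

/-! ### The algorithm -/

/-- `Δ_n = ∑ (𝒟_i⁻ - 𝒟_i⁺)`. -/
def imbalance {n : ℕ} (x : Fin n → ℕ × ℕ) : ℤ := ∑ i, (((x i).1 : ℤ) - ((x i).2 : ℤ))

/-- The acceptance test of Step 2: `|Δ_n| ≤ n^{1-δ}`. -/
def Accept (δ : ℝ) {n : ℕ} (x : Fin n → ℕ × ℕ) : Prop :=
  ((|imbalance x| : ℤ) : ℝ) ≤ (n : ℝ) ^ (1 - δ)

/-- The successive samples drawn in Step 1: `ω k i` is the pair of node `i` in round `k`. -/
abbrev Rounds (n : ℕ) : Type := ℕ → Fin n → ℕ × ℕ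

/-- All pairs, in all rounds, are i.i.d. with law `G`. -/
def roundsLaw (G : Measure (ℕ × ℕ)) [IsProbabilityMeasure G] (n : ℕ) : Measure (Rounds n) :=
  Measure.infinitePi fun _ : ℕ => Measure.pi fun _ : Fin n => G

/-- The algorithm leaves the loop formed by Steps 1 and 2. -/
def Terminates (δ : ℝ) {n : ℕ} (ω : Rounds n) : Prop := ∃ k, Accept δ (ω k)

open Classical in
/-- The first accepted sample (the zero sequence if the loop never ends). -/
def accepted (δ : ℝ) {n : ℕ} (ω : Rounds n) : Fin n → ℕ × ℕ :=
  if h : Terminates δ ω then ω (Nat.find h) else 0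

lemma measurable_accepted (δ : ℝ) (n : ℕ) :
    Measurable (accepted δ : Rounds n → Fin n → ℕ × ℕ) := by
  classical
  have hA : ∀ k, MeasurableSet {ω : Rounds n | Accept δ (ω k)} := fun k =>
    (MeasurableSet.of_discrete (s := {x : Fin n → ℕ × ℕ | Accept δ x})).preimage
      (measurable_pi_apply k)
  refine measurable_to_countable' fun x => ?_
  have : accepted δ ⁻¹' {x} =
      (⋃ k, ({ω : Rounds n | Accept δ (ω k)} ∩ (⋂ j, ⋂ _ : j < k, {ω | Accept δ (ω j)}ᶜ) ∩
        {ω | ω k = x})) ∪ ((⋂ k, {ω | Accept δ (ω k)}ᶜ) ∩ {_ω | x = 0}) := by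
    ext ω
    by_cases h : Terminates δ ω
    · have hn : ¬ ∀ k, ¬ Accept δ (ω k) := by simpa [Terminates] using h
      simp only [Set.mem_preimage, Set.mem_singleton_iff, accepted, dif_pos h, Set.mem_union,
        Set.mem_iUnion, Set.mem_inter_iff, Set.mem_ofPred_eq, Set.mem_iInter, Set.mem_compl_iff,
        hn, false_and, or_false]
      constructor
      · intro e
        exact ⟨Nat.find h, ⟨Nat.find_spec h, fun j hj => Nat.find_min h hj⟩, e⟩
      · rintro ⟨k, ⟨hk, hj⟩, e⟩
        have : Nat.find h = k := (Nat.find_eq_iff h).2 ⟨hk, hj⟩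
        rw [this, e]
    · have hn : ∀ k, ¬ Accept δ (ω k) := by simpa [Terminates] using h
      simp [accepted, h, hn, eq_comm]
  rw [this]
  refine MeasurableSet.union (MeasurableSet.iUnion fun k => ((hA k).inter ?_).inter ?_) ?_
  · exact MeasurableSet.iInter fun j => MeasurableSet.iInter fun _ => (hA j).compl
  · exact (measurableSet_singleton x).preimage (measurable_pi_apply k)
  · exact (MeasurableSet.iInter fun k => (hA k).compl).inter (MeasurableSet.const _)

/-- Step 3, the selection: given the rounds, a uniformly random set of `|Δ_n|` indices. -/
def selection (δ : ℝ) (n : ℕ) : Kernel (Rounds n) (Finset (Fin n)) where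
  toFun ω := uniformOn {s : Finset (Fin n) | s.card = (imbalance (accepted δ ω)).natAbs}
  measurable' := (measurable_of_countable fun x : Fin n → ℕ × ℕ =>
    (uniformOn {s : Finset (Fin n) | s.card = (imbalance x).natAbs} :
      Measure (Finset (Fin n)))).comp (measurable_accepted δ n)

lemma natAbs_imbalance_accepted_le {δ : ℝ} (hδ : 0 ≤ δ) {n : ℕ} (ω : Rounds n) :
    (imbalance (accepted δ ω)).natAbs ≤ n := by
  classical
  by_cases h : Terminates δ ω
  · have h1 : Accept δ (accepted δ ω) := by
      rw [accepted, dif_pos h]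
      exact Nat.find_spec h
    rcases Nat.eq_zero_or_pos n with rfl | hn
    · simp [imbalance]
    · have h2 : (n : ℝ) ^ (1 - δ) ≤ (n : ℝ) := by
        calc (n : ℝ) ^ (1 - δ) ≤ (n : ℝ) ^ (1 : ℝ) :=
              Real.rpow_le_rpow_of_exponent_le (by exact_mod_cast hn) (by linarith)
          _ = n := Real.rpow_one _
      have h3 : ((|imbalance (accepted δ ω)| : ℤ) : ℝ) ≤ ((n : ℤ) : ℝ) := by
        exact_mod_cast h1.trans h2
      have h4 : |imbalance (accepted δ ω)| ≤ (n : ℤ) := by exact_mod_cast h3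
      rw [Int.abs_eq_natAbs] at h4
      exact_mod_cast h4
  · simp [accepted, h, imbalance]

/-- The selection is a genuine probability distribution for every realization of the rounds. -/
lemma isMarkovKernel_selection {δ : ℝ} (hδ : 0 ≤ δ) (n : ℕ) : IsMarkovKernel (selection δ n) := by
  refine ⟨fun ω => ?_⟩
  obtain ⟨s, -, hs⟩ := Finset.exists_subset_card_eq
    (s := (Finset.univ : Finset (Fin n))) (n := (imbalance (accepted δ ω)).natAbs)
    (by simpa using natAbs_imbalance_accepted_le hδ ω)
  exact isProbabilityMeasure_uniformOn (Set.toFinite _) ⟨s, hs⟩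

/-- The joint law of the sampled rounds and of the selected set of indices. -/
def algorithmLaw (G : Measure (ℕ × ℕ)) [IsProbabilityMeasure G] (δ : ℝ) (n : ℕ) :
    Measure (Rounds n × Finset (Fin n)) :=
  (roundsLaw G n).compProd (selection δ n)

/-- Step 3, the correction: the selected nodes get one more inbound stub if `Δ_n ≤ 0`,
and one more outbound stub if `Δ_n > 0`. -/
def corrected {n : ℕ} (x : Fin n → ℕ × ℕ) (s : Finset (Fin n)) (i : Fin n) : ℕ × ℕ :=
  ((x i).1 + (if imbalance x ≤ 0 ∧ i ∈ s then 1 else 0),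
    (x i).2 + (if 0 < imbalance x ∧ i ∈ s then 1 else 0))

/-- The sequence `(D_i⁻, D_i⁺)` returned by the algorithm. -/
def output (δ : ℝ) {n : ℕ} (ω : Rounds n × Finset (Fin n)) : Fin n → ℕ × ℕ :=
  corrected (accepted δ ω.1) ω.2

/-- The event `Ω_n`: the algorithm returns a sequence, and this sequence is regular. -/
def regularEvent (G : Measure (ℕ × ℕ)) (δ κ ε K : ℝ) (n : ℕ) :
    Set (Rounds n × Finset (Fin n)) :=
  {ω | Terminates δ ω.1 ∧ IsRegular G κ ε K (output δ ω)}

end IIDAlgorithm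

end

/-!
For integer-valued variables with weights, the Kantorovich–Rubinstein distance is at most the sum
over `t` of the differences of the weighted tails `[t, ∞)` (quantile coupling), up to a constant
coming from the normalization. By truncation and Chebyshev, an average of `n` i.i.d. variables with
finite `q`-th moment, `1 < q ≤ 2`, deviates from its mean by `O(n ^ (1 / q - 1))` in `L¹`. Applied
to each tail, with a slightly smaller exponent to make the bounds summable over `t`, this controls
the four distances for the sample of the first round; applied to `𝒟⁻ - 𝒟⁺` it shows that this
round is accepted with high probability, so that conditioning on acceptance is harmless. Finally
Step 3 selects only `n ^ (1 - δ)` nodes uniformly at random, and changing their degrees by one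
alters every average by at most a constant times the share of the integrable quantity
`((𝒟⁻ + 1) (𝒟⁺ + 1)) ^ (1 + κ)` carried by the selected nodes, which is `O(n ^ (-δ))` in mean.
-/

noncomputable section

namespace IIDAlgorithm

/-! ### Laws on the non-negative integers -/

/-- The `ℓ¹` distance between the tails `t ↦ P [t, ∞)` of two finite measures on `ℕ`. The total
masses enter through `t = 0`, so the measures need not be normalized. -/
def tailDist (P Q : Measure ℕ) : ℝ≥0∞ :=
  ∑' t, ENNReal.ofReal |P.real (Set.Ici t) - Q.real (Set.Ici t)|

lemma tailDist_triangle (P Q R : Measure ℕ) : tailDist P R ≤ tailDist P Q + tailDist Q R := by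
  rw [tailDist, tailDist, tailDist, ← ENNReal.tsum_add]
  refine ENNReal.tsum_le_tsum fun t => ?_
  rw [← ENNReal.ofReal_add (abs_nonneg _) (abs_nonneg _)]
  exact ENNReal.ofReal_le_ofReal (abs_sub_le _ _ _)

/-- The quantile function of a law on `ℕ`; its values at `u ≥ 1` carry no meaning. -/
def quantile (P : Measure ℕ) (u : ℝ) : ℕ := sInf {t : ℕ | u ≤ P.real (Set.Iic t)}

/-- The uniform law on the unit interval, the common source of the quantile coupling. -/
def unitLaw : Measure ℝ := volume.restrict (Set.Ioo 0 1)

instance : IsProbabilityMeasure unitLaw := ⟨by simp [unitLaw]⟩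

lemma ae_unitLaw_mem_Ioo : ∀ᵐ u ∂unitLaw, u ∈ Set.Ioo (0 : ℝ) 1 :=
  ae_restrict_mem measurableSet_Ioo

lemma unitLaw_Iic {u : ℝ} (hu : u ≤ 1) : unitLaw (Set.Iic u) = ENNReal.ofReal u := by
  rw [unitLaw, restrict_Ioo_eq_restrict_Ioc, Measure.restrict_apply measurableSet_Iic,
    Set.Iic_inter_Ioc_of_le hu, Real.volume_Ioc, sub_zero]

section Quantile

variable (P Q : Measure ℕ) [IsProbabilityMeasure P] [IsProbabilityMeasure Q]

lemma quantile_le_iff {u : ℝ} (hu : u < 1) (t : ℕ) : quantile P u ≤ t ↔ u ≤ P.real (Set.Iic t) := by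
  have hlim : Tendsto (fun t : ℕ => P.real (Set.Iic t)) atTop (𝓝 1) := by
    simpa [Function.comp_def, measureReal_def] using
      (ENNReal.tendsto_toReal (measure_ne_top P Set.univ)).comp (tendsto_measure_Iic_atTop P)
  obtain ⟨s, hs⟩ := (hlim.eventually_const_le hu).exists
  have hmem : u ≤ P.real (Set.Iic (quantile P u)) :=
    Nat.sInf_mem (s := {t : ℕ | u ≤ P.real (Set.Iic t)}) ⟨s, hs⟩
  exact ⟨fun h => hmem.trans (measureReal_mono (Set.Iic_subset_Iic.2 h)), fun h => Nat.sInf_le h⟩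

lemma aemeasurable_quantile : AEMeasurable (quantile P) unitLaw := by
  refine aemeasurable_restrict_of_monotoneOn measurableSet_Ioo fun u hu v hv huv => ?_
  exact (quantile_le_iff P hu.2 _).2 (huv.trans ((quantile_le_iff P hv.2 _).1 le_rfl))

lemma map_quantile : unitLaw.map (quantile P) = P := by
  have := Measure.isProbabilityMeasure_map (aemeasurable_quantile P)
  refine Measure.ext_of_Iic _ _ fun t => ?_
  have h : quantile P ⁻¹' Set.Iic t =ᵐ[unitLaw] Set.Iic (P.real (Set.Iic t)) := by
    filter_upwards [ae_unitLaw_mem_Ioo] with u hu using propext (quantile_le_iff P hu.2 t)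
  rw [Measure.map_apply_of_aemeasurable (aemeasurable_quantile P) measurableSet_Iic,
    measure_congr h, unitLaw_Iic measureReal_le_one, ofReal_measureReal]

lemma map_quantile_mem_couplings :
    unitLaw.map (fun u => ((quantile P u : ℝ), (quantile Q u : ℝ))) ∈
      couplings (P.map fun t : ℕ => (t : ℝ)) (Q.map fun t : ℕ => (t : ℝ)) := by
  have hcast : Measurable fun t : ℕ => (t : ℝ) := measurable_of_countable _
  have hP := hcast.comp_aemeasurable (aemeasurable_quantile P)
  have hQ := hcast.comp_aemeasurable (aemeasurable_quantile Q)
  have hpair := hP.prodMk hQ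
  refine ⟨Measure.isProbabilityMeasure_map hpair, ?_, ?_⟩
  · conv_rhs => rw [← map_quantile P, AEMeasurable.map_map_of_aemeasurable hcast.aemeasurable
      (aemeasurable_quantile P)]
    exact AEMeasurable.map_map_of_aemeasurable measurable_fst.aemeasurable hpair
  · conv_rhs => rw [← map_quantile Q, AEMeasurable.map_map_of_aemeasurable hcast.aemeasurable
      (aemeasurable_quantile Q)]
    exact AEMeasurable.map_map_of_aemeasurable measurable_snd.aemeasurable hpair

lemma ofReal_abs_natCast_sub_eq_tsum (a b : ℕ) :
    ENNReal.ofReal |(a : ℝ) - b| = ∑' t, (Set.Ico (min a b) (max a b)).indicator 1 t := by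
  have hcard : ∑' t, (Set.Ico (min a b) (max a b)).indicator (1 : ℕ → ℝ≥0∞) t =
      (max a b - min a b : ℕ) := by
    rw [← Finset.coe_Ico, ← tsum_subtype, Finset.tsum_subtype']
    simp
  rw [hcard, ← max_sub_min_eq_abs', ← ENNReal.ofReal_natCast, Nat.cast_sub min_le_max,
    Nat.cast_max, Nat.cast_min]

lemma indicator_Ico_quantile_eq {u : ℝ} (hu : u < 1) (t : ℕ) :
    (Set.Ico (min (quantile P u) (quantile Q u)) (max (quantile P u) (quantile Q u))).indicator
        (1 : ℕ → ℝ≥0∞) t =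
      (Set.Ioc (min (P.real (Set.Iic t)) (Q.real (Set.Iic t)))
        (max (P.real (Set.Iic t)) (Q.real (Set.Iic t)))).indicator 1 u := by
  have hmem : t ∈ Set.Ico (min (quantile P u) (quantile Q u)) (max (quantile P u) (quantile Q u)) ↔
      u ∈ Set.Ioc (min (P.real (Set.Iic t)) (Q.real (Set.Iic t)))
        (max (P.real (Set.Iic t)) (Q.real (Set.Iic t))) := by
    simp only [Set.mem_Ico, Set.mem_Ioc, min_le_iff, le_max_iff, ← not_le, max_le_iff, le_min_iff,
      quantile_le_iff _ hu]
    tauto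
  simp only [Set.indicator_apply, hmem, Pi.one_apply]

theorem lintegral_abs_quantile_sub_le_tailDist :
    ∫⁻ u, ENNReal.ofReal |(quantile P u : ℝ) - quantile Q u| ∂unitLaw ≤ tailDist P Q := by
  have hIic (R : Measure ℕ) [IsProbabilityMeasure R] (t : ℕ) :
      R.real (Set.Iic t) = 1 - R.real (Set.Ici (t + 1)) := by
    rw [← probReal_compl_eq_one_sub measurableSet_Ici, Set.compl_Ici]
    congr 1; ext s; simp
  have hslice (t : ℕ) : volume (Set.Ioc (min (P.real (Set.Iic t)) (Q.real (Set.Iic t)))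
      (max (P.real (Set.Iic t)) (Q.real (Set.Iic t)))) =
      ENNReal.ofReal |P.real (Set.Ici (t + 1)) - Q.real (Set.Ici (t + 1))| := by
    rw [Real.volume_Ioc, max_sub_min_eq_abs', hIic P, hIic Q, sub_sub_sub_cancel_left, abs_sub_comm]
  calc ∫⁻ u, ENNReal.ofReal |(quantile P u : ℝ) - quantile Q u| ∂unitLaw
      = ∫⁻ u, ∑' t, (Set.Ioc (min (P.real (Set.Iic t)) (Q.real (Set.Iic t)))
          (max (P.real (Set.Iic t)) (Q.real (Set.Iic t)))).indicator 1 u ∂unitLaw := by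
        refine lintegral_congr_ae ?_
        filter_upwards [ae_unitLaw_mem_Ioo] with u hu
        simp_rw [ofReal_abs_natCast_sub_eq_tsum, indicator_Ico_quantile_eq P Q hu.2]
    _ = ∑' t, unitLaw (Set.Ioc (min (P.real (Set.Iic t)) (Q.real (Set.Iic t)))
          (max (P.real (Set.Iic t)) (Q.real (Set.Iic t)))) := by
        rw [lintegral_tsum fun t => (measurable_one.indicator measurableSet_Ioc).aemeasurable]
        simp_rw [lintegral_indicator_one measurableSet_Ioc]
    _ ≤ ∑' t, ENNReal.ofReal |P.real (Set.Ici (t + 1)) - Q.real (Set.Ici (t + 1))| :=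
        ENNReal.tsum_le_tsum fun t => (Measure.restrict_apply_le _ _).trans_eq (hslice t)
    _ ≤ tailDist P Q := ENNReal.tsum_comp_le_tsum_of_injective Nat.succ_injective
        fun t => ENNReal.ofReal |P.real (Set.Ici t) - Q.real (Set.Ici t)|

theorem d₁_map_natCast_le_tailDist :
    d₁ (P.map fun t : ℕ => (t : ℝ)) (Q.map fun t : ℕ => (t : ℝ)) ≤ tailDist P Q := by
  have hcast : Measurable fun t : ℕ => (t : ℝ) := measurable_of_countable _
  have hpair := (hcast.comp_aemeasurable (aemeasurable_quantile P)).prodMk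
    (hcast.comp_aemeasurable (aemeasurable_quantile Q))
  refine (iInf₂_le _ (map_quantile_mem_couplings P Q)).trans ?_
  exact (lintegral_map' (by fun_prop) hpair).trans_le (lintegral_abs_quantile_sub_le_tailDist P Q)

end Quantile

/-- The probability law on `ℝ` proportional to the finite measure `P` on `ℕ`. -/
def normalizedLaw (P : Measure ℕ) : Measure ℝ :=
  ((P Set.univ)⁻¹ • P).map fun t : ℕ => (t : ℝ)

lemma abs_div_sub_div_le {a b a₀ b₀ : ℝ} (ha₀ : 0 < a₀) (hb₀ : 0 < b₀) (hb : 0 ≤ b) :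
    |a / a₀ - b / b₀| ≤ a₀⁻¹ * |a - b| + |a₀ - b₀| / (a₀ * b₀) * b := by
  have hsplit : a / a₀ - b / b₀ = a₀⁻¹ * (a - b) + (b₀ - a₀) / (a₀ * b₀) * b := by
    field_simp; ring
  rw [hsplit]
  refine (abs_add_le _ _).trans_eq ?_
  rw [abs_mul, abs_mul, abs_div, abs_of_pos (inv_pos.2 ha₀), abs_of_pos (mul_pos ha₀ hb₀),
    abs_of_nonneg hb, abs_sub_comm b₀]

lemma tailDist_normalize_le (P Q : Measure ℕ) [IsFiniteMeasure P] [IsFiniteMeasure Q]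
    [NeZero P] [NeZero Q] :
    tailDist ((P Set.univ)⁻¹ • P) ((Q Set.univ)⁻¹ • Q) ≤
      ENNReal.ofReal (P.real Set.univ)⁻¹ * tailDist P Q +
        ENNReal.ofReal (|P.real Set.univ - Q.real Set.univ| /
          (P.real Set.univ * Q.real Set.univ)) * ∑' t, Q (Set.Ici t) := by
  have hP₀ : 0 < P.real Set.univ := measureReal_univ_pos
  have hQ₀ : 0 < Q.real Set.univ := measureReal_univ_pos
  rw [tailDist, tailDist, ← ENNReal.tsum_mul_left, ← ENNReal.tsum_mul_left, ← ENNReal.tsum_add]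
  refine ENNReal.tsum_le_tsum fun t => ?_
  have hterm := abs_div_sub_div_le (a := P.real (Set.Ici t)) hP₀ hQ₀
    (measureReal_nonneg (μ := Q) (s := Set.Ici t))
  calc ENNReal.ofReal |((P Set.univ)⁻¹ • P).real (Set.Ici t) -
        ((Q Set.univ)⁻¹ • Q).real (Set.Ici t)|
      = ENNReal.ofReal |P.real (Set.Ici t) / P.real Set.univ -
          Q.real (Set.Ici t) / Q.real Set.univ| := by
        simp [measureReal_def, ENNReal.toReal_inv, div_eq_inv_mul]
    _ ≤ _ := ENNReal.ofReal_le_ofReal hterm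
    _ = _ := by
        rw [ENNReal.ofReal_add (by positivity) (by positivity),
          ENNReal.ofReal_mul (by positivity), ENNReal.ofReal_mul (by positivity),
          ofReal_measureReal]

theorem exists_d₁_normalizedLaw_le (Q : Measure ℕ) [IsFiniteMeasure Q] [NeZero Q]
    (hmean : ∑' t, Q (Set.Ici t) ≠ ∞) :
    ∃ C : ℝ, ∀ P : Measure ℕ, IsFiniteMeasure P → ∀ r ≤ Q.real Set.univ / 2, 0 ≤ r →
      tailDist P Q ≤ ENNReal.ofReal r →
        d₁ (normalizedLaw P) (normalizedLaw Q) ≤ ENNReal.ofReal (C * r) := by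
  set c := Q.real Set.univ
  set B := (∑' t, Q (Set.Ici t)).toReal
  have hc : 0 < c := measureReal_univ_pos
  refine ⟨(c / 2)⁻¹ + B / (c / 2 * c), fun P hP r hrc hr hPQ => ?_⟩
  have hmass : |P.real Set.univ - c| ≤ r := by
    have := (ENNReal.le_tsum 0).trans hPQ
    rwa [ENNReal.ofReal_le_ofReal_iff hr, ← bot_eq_zero, Set.Ici_bot] at this
  have hPc : c / 2 ≤ P.real Set.univ := by linarith [(abs_le.1 hmass).1]
  have : NeZero P := ⟨by rintro rfl; simp at hPc; linarith⟩
  calc d₁ (normalizedLaw P) (normalizedLaw Q)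
      ≤ tailDist ((P Set.univ)⁻¹ • P) ((Q Set.univ)⁻¹ • Q) := d₁_map_natCast_le_tailDist _ _
    _ ≤ _ := tailDist_normalize_le P Q
    _ ≤ ENNReal.ofReal (c / 2)⁻¹ * ENNReal.ofReal r +
          ENNReal.ofReal (r / (c / 2 * c)) * ENNReal.ofReal B := by
        rw [ENNReal.ofReal_toReal hmean]
        gcongr
    _ = ENNReal.ofReal (((c / 2)⁻¹ + B / (c / 2 * c)) * r) := by
        have : 0 ≤ B := ENNReal.toReal_nonneg
        rw [← ENNReal.ofReal_mul (by positivity), ← ENNReal.ofReal_mul (by positivity),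
          ← ENNReal.ofReal_add (by positivity) (by positivity)]
        congr 1; ring

/-! ### Events of probability tending to one -/

/-- The property `P n` of a sample from `μ n` fails with (outer) probability tending to `0`. -/
def WithHighProbability {Ω : ℕ → Type*} [∀ n, MeasurableSpace (Ω n)] (μ : ∀ n, Measure (Ω n))
    (P : ∀ n, Ω n → Prop) : Prop :=
  Tendsto (fun n => μ n {ω | ¬ P n ω}) atTop (𝓝 0)

lemma eventually_const_mul_rpow_neg_le (C : ℝ) {a b : ℝ} (hab : a < b) :
    ∀ᶠ n : ℕ in atTop, C * (n : ℝ) ^ (-b) ≤ (n : ℝ) ^ (-a) := by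
  have hlim := ((tendsto_rpow_neg_atTop (sub_pos.2 hab)).comp
    tendsto_natCast_atTop_atTop).const_mul C
  rw [mul_zero] at hlim
  filter_upwards [hlim.eventually_le_const zero_lt_one, eventually_gt_atTop 0] with n hn hn₀
  have hn₀' : (0 : ℝ) < n := Nat.cast_pos.2 hn₀
  calc C * (n : ℝ) ^ (-b) = (C * (n : ℝ) ^ (-(b - a))) * (n : ℝ) ^ (-a) := by
        rw [mul_assoc, ← Real.rpow_add hn₀']; ring_nf
    _ ≤ 1 * (n : ℝ) ^ (-a) := mul_le_mul_of_nonneg_right hn (by positivity)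
    _ = (n : ℝ) ^ (-a) := one_mul _

namespace WithHighProbability

variable {Ω Ω' : ℕ → Type*} [∀ n, MeasurableSpace (Ω n)] [∀ n, MeasurableSpace (Ω' n)]
  {μ : ∀ n, Measure (Ω n)} {μ' : ∀ n, Measure (Ω' n)} {P Q : ∀ n, Ω n → Prop}

lemma mono (hP : WithHighProbability μ P) (hPQ : ∀ᶠ n in atTop, ∀ᵐ ω ∂μ n, P n ω → Q n ω) :
    WithHighProbability μ Q := by
  refine tendsto_of_tendsto_of_tendsto_of_le_of_le' tendsto_const_nhds hP
    (Eventually.of_forall fun _ => zero_le) ?_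
  filter_upwards [hPQ] with n hn
  exact measure_mono_ae (hn.mono fun ω h hQ hPω => hQ (h hPω))

lemma and (hP : WithHighProbability μ P) (hQ : WithHighProbability μ Q) :
    WithHighProbability μ fun n ω => P n ω ∧ Q n ω := by
  refine tendsto_of_tendsto_of_tendsto_of_le_of_le tendsto_const_nhds
    (by simpa using Tendsto.add hP hQ) (fun _ => zero_le) fun n => ?_
  refine (measure_mono fun ω hω => ?_).trans (measure_union_le _ _)
  exact not_and_or.1 hω

lemma comp_measurePreserving (hP : WithHighProbability μ P) {f : ∀ n, Ω' n → Ω n}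
    (hf : ∀ n, MeasurePreserving (f n) (μ' n) (μ n)) :
    WithHighProbability μ' fun n ω => P n (f n ω) := by
  refine tendsto_of_tendsto_of_tendsto_of_le_of_le tendsto_const_nhds hP (fun _ => zero_le)
    fun n => ?_
  conv_rhs => rw [← (hf n).map_eq]
  exact Measure.le_map_apply (hf n).aemeasurable _

lemma tendsto_measure [∀ n, IsProbabilityMeasure (μ n)] (hP : WithHighProbability μ P) :
    Tendsto (fun n => μ n {ω | P n ω}) atTop (𝓝 1) := by
  have hlow := ENNReal.Tendsto.sub (tendsto_const_nhds (x := (1 : ℝ≥0∞))) hP (by simp)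
  rw [tsub_zero] at hlow
  refine tendsto_of_tendsto_of_tendsto_of_le_of_le hlow tendsto_const_nhds (fun n => ?_)
    fun n => prob_le_one
  refine tsub_le_iff_right.2 ?_
  calc (1 : ℝ≥0∞) = μ n ({ω | P n ω} ∪ {ω | ¬ P n ω}) := by
        rw [← Set.compl_ofPred, Set.union_compl_self, measure_univ]
    _ ≤ μ n {ω | P n ω} + μ n {ω | ¬ P n ω} := measure_union_le _ _

lemma of_lintegral_le {f : ∀ n, Ω n → ℝ≥0∞} (hf : ∀ n, AEMeasurable (f n) (μ n)) {C a b : ℝ}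
    (hab : a < b)
    (hle : ∀ᶠ n : ℕ in atTop, ∫⁻ ω, f n ω ∂μ n ≤ ENNReal.ofReal (C * (n : ℝ) ^ (-b))) :
    WithHighProbability μ fun n ω => f n ω ≤ ENNReal.ofReal ((n : ℝ) ^ (-a)) := by
  have hlim : Tendsto (fun n : ℕ => ENNReal.ofReal (C * (n : ℝ) ^ (-(b - a)))) atTop (𝓝 0) := by
    have := ((tendsto_rpow_neg_atTop (sub_pos.2 hab)).comp
      tendsto_natCast_atTop_atTop).const_mul C
    simpa [Function.comp_def] using ENNReal.tendsto_ofReal this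
  refine tendsto_of_tendsto_of_tendsto_of_le_of_le' tendsto_const_nhds hlim
    (Eventually.of_forall fun _ => zero_le) ?_
  filter_upwards [hle, eventually_gt_atTop 0] with n hn hn₀
  have hn₀' : (0 : ℝ) < n := Nat.cast_pos.2 hn₀
  have ha : 0 < (n : ℝ) ^ (-a) := Real.rpow_pos_of_pos hn₀' _
  calc μ n {ω | ¬ f n ω ≤ ENNReal.ofReal ((n : ℝ) ^ (-a))}
      ≤ μ n {ω | ENNReal.ofReal ((n : ℝ) ^ (-a)) ≤ f n ω} :=
        measure_mono fun ω hω => (not_le.1 hω).le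
    _ ≤ (∫⁻ ω, f n ω ∂μ n) / ENNReal.ofReal ((n : ℝ) ^ (-a)) :=
        meas_ge_le_lintegral_div (hf n) (by simpa using ha) ENNReal.ofReal_ne_top
    _ ≤ ENNReal.ofReal (C * (n : ℝ) ^ (-b)) / ENNReal.ofReal ((n : ℝ) ^ (-a)) := by gcongr
    _ = ENNReal.ofReal (C * (n : ℝ) ^ (-(b - a))) := by
        rw [← ENNReal.ofReal_div_of_pos ha, mul_div_assoc, ← Real.rpow_sub hn₀']
        ring_nf

end WithHighProbability

/-! ### Deviations of i.i.d. sums -/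

section Sums

variable {Ω : Type*} [MeasurableSpace Ω]

/-- The law of `n` independent samples from `μ`. -/
abbrev iidLaw (μ : Measure Ω) (n : ℕ) : Measure (Fin n → Ω) := Measure.pi fun _ => μ

variable {μ : Measure Ω} {w : Ω → ℝ} {p M : ℝ}

lemma sq_le_rpow_mul_rpow {a : ℝ} (ha : 0 ≤ a) (haM : a ≤ M) (hp : p ≤ 2) :
    a ^ 2 ≤ M ^ (2 - p) * a ^ p :=
  calc a ^ 2 = a ^ ((2 - p) + p) := by rw [sub_add_cancel, Real.rpow_two]
    _ = a ^ (2 - p) * a ^ p := Real.rpow_add' ha (by norm_num)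
    _ ≤ M ^ (2 - p) * a ^ p := by gcongr

lemma le_rpow_mul_rpow {a : ℝ} (hM : 0 < M) (haM : M ≤ a) (hp : 1 ≤ p) :
    a ≤ M ^ (1 - p) * a ^ p := by
  have ha := hM.trans_le haM
  calc a = a ^ ((1 - p) + p) := by rw [sub_add_cancel, Real.rpow_one]
    _ = a ^ (1 - p) * a ^ p := Real.rpow_add ha _ _
    _ ≤ M ^ (1 - p) * a ^ p := by
      gcongr ?_ * _
      exact Real.rpow_le_rpow_of_nonpos hM haM (by linarith)

lemma integral_sq_indicator_abs_le_le (hM : 0 ≤ M) (hp : p ≤ 2)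
    (hwp : Integrable (fun ω => |w ω| ^ p) μ) :
    ∫ ω, {ω | |w ω| ≤ M}.indicator w ω ^ 2 ∂μ ≤ M ^ (2 - p) * ∫ ω, |w ω| ^ p ∂μ := by
  rw [← integral_const_mul]
  refine integral_mono_of_nonneg (ae_of_all _ fun ω => sq_nonneg _) (hwp.const_mul _)
    (ae_of_all _ fun ω => ?_)
  by_cases h : |w ω| ≤ M
  · simpa [h] using sq_le_rpow_mul_rpow (abs_nonneg _) h hp
  · simp only [Set.indicator_apply, Set.mem_ofPred_eq, h, if_false, zero_pow two_ne_zero]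
    positivity

lemma integral_abs_indicator_compl_abs_le_le (hM : 0 < M) (hp : 1 ≤ p)
    (hwp : Integrable (fun ω => |w ω| ^ p) μ) :
    ∫ ω, |{ω | |w ω| ≤ M}ᶜ.indicator w ω| ∂μ ≤ M ^ (1 - p) * ∫ ω, |w ω| ^ p ∂μ := by
  rw [← integral_const_mul]
  refine integral_mono_of_nonneg (ae_of_all _ fun ω => abs_nonneg _) (hwp.const_mul _)
    (ae_of_all _ fun ω => ?_)
  by_cases h : |w ω| ≤ M
  · simp only [Set.indicator_apply, Set.mem_compl_iff, Set.mem_ofPred_eq, h, not_true_eq_false,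
      if_false, abs_zero]
    positivity
  · simpa [h] using le_rpow_mul_rpow hM (not_le.1 h).le hp

lemma measurable_sum_eval (hm : Measurable w) (n : ℕ) :
    Measurable fun x : Fin n → Ω => ∑ i, w (x i) :=
  Finset.measurable_sum _ fun i _ => hm.comp (measurable_pi_apply i)

variable [IsProbabilityMeasure μ]

lemma integral_abs_le_sqrt_integral_sq {f : Ω → ℝ} (hf : MemLp f 2 μ) :
    ∫ ω, |f ω| ∂μ ≤ √(∫ ω, f ω ^ 2 ∂μ) := by
  refine Real.le_sqrt_of_sq_le ?_
  have habs : MemLp (fun ω => |f ω|) 2 μ := hf.abs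
  have hvar := variance_nonneg (fun ω => |f ω|) μ
  rw [variance_eq_sub habs] at hvar
  simpa using hvar

lemma integrable_sum_eval (hw : Integrable w μ) (n : ℕ) :
    Integrable (fun x : Fin n → Ω => ∑ i, w (x i)) (iidLaw μ n) :=
  integrable_finsetSum _ fun i _ => integrable_comp_eval (μ := fun _ : Fin n => μ) (i := i) hw

lemma integral_sum_eval (hw : Integrable w μ) (n : ℕ) :
    ∫ x, ∑ i, w (x i) ∂iidLaw μ n = n * ∫ ω, w ω ∂μ := by
  rw [integral_finsetSum _ fun i _ =>
    integrable_comp_eval (μ := fun _ : Fin n => μ) (i := i) hw]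
  simp [integral_comp_eval (μ := fun _ : Fin n => μ) hw.1]

lemma integral_abs_sum_eval_sub_le_sqrt (hw : MemLp w 2 μ) (n : ℕ) :
    ∫ x, |∑ i, w (x i) - n * ∫ ω, w ω ∂μ| ∂iidLaw μ n ≤ √(n * ∫ ω, w ω ^ 2 ∂μ) := by
  have hsum : MemLp (fun x : Fin n → Ω => ∑ i, w (x i)) 2 (iidLaw μ n) :=
    memLp_finsetSum _ fun i _ => hw.comp_measurePreserving (measurePreserving_eval _ i)
  have hvar : Var[fun x : Fin n → Ω => ∑ i, w (x i); iidLaw μ n] = n * Var[w; μ] := by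
    simpa [Finset.sum_fn] using variance_sum_pi (μ := fun _ : Fin n => μ) (X := fun _ => w)
      fun _ => hw
  rw [variance_eq_integral hsum.1.aemeasurable,
    integral_sum_eval (hw.integrable one_le_two)] at hvar
  refine (integral_abs_le_sqrt_integral_sq (hsum.sub (memLp_const _))).trans
    (Real.sqrt_le_sqrt (hvar.le.trans ?_))
  exact mul_le_mul_of_nonneg_left (variance_le_expectation_sq hw.1) n.cast_nonneg

lemma integral_abs_sum_eval_sub_le_two_mul (hw : Integrable w μ) (n : ℕ) :
    ∫ x, |∑ i, w (x i) - n * ∫ ω, w ω ∂μ| ∂iidLaw μ n ≤ 2 * (n * ∫ ω, |w ω| ∂μ) := by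
  have habs : |n * ∫ ω, w ω ∂μ| ≤ n * ∫ ω, |w ω| ∂μ := by
    rw [abs_mul, Nat.abs_cast]
    exact mul_le_mul_of_nonneg_left (abs_integral_le_integral_abs) n.cast_nonneg
  calc ∫ x, |∑ i, w (x i) - n * ∫ ω, w ω ∂μ| ∂iidLaw μ n
      ≤ ∫ x, (∑ i, |w (x i)| + n * ∫ ω, |w ω| ∂μ) ∂iidLaw μ n := by
        refine integral_mono ((integrable_sum_eval hw n).sub (integrable_const _)).abs
          ((integrable_sum_eval hw.abs n).add (integrable_const _)) fun x => ?_
        exact (abs_sub _ _).trans (add_le_add (Finset.abs_sum_le_sum_abs _ _) habs)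
    _ = 2 * (n * ∫ ω, |w ω| ∂μ) := by
        rw [integral_add (integrable_sum_eval hw.abs n) (integrable_const _),
          integral_sum_eval hw.abs, integral_const, probReal_univ]
        simp only [smul_eq_mul]; ring

lemma integral_abs_sum_eval_add_sub_le {v : Ω → ℝ} (hv : Integrable v μ) (hw : Integrable w μ)
    (n : ℕ) :
    ∫ x, |∑ i, (v (x i) + w (x i)) - n * ∫ ω, (v ω + w ω) ∂μ| ∂iidLaw μ n ≤
      ∫ x, |∑ i, v (x i) - n * ∫ ω, v ω ∂μ| ∂iidLaw μ n +
        ∫ x, |∑ i, w (x i) - n * ∫ ω, w ω ∂μ| ∂iidLaw μ n := by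
  have hdev {u : Ω → ℝ} (hu : Integrable u μ) : Integrable
      (fun x : Fin n → Ω => |∑ i, u (x i) - n * ∫ ω, u ω ∂μ|) (iidLaw μ n) :=
    ((integrable_sum_eval hu n).sub (integrable_const _)).abs
  rw [← integral_add (hdev hv) (hdev hw), integral_add hv hw]
  refine integral_mono ?_ ((hdev hv).add (hdev hw)) fun x => ?_
  · simpa only [integral_add hv hw, Pi.add_apply] using hdev (hv.add hw)
  · simp only [Finset.sum_add_distrib, mul_add, add_sub_add_comm]
    exact abs_add_le _ _

lemma integrable_of_integrable_abs_rpow (hm : Measurable w) (hp : 1 ≤ p)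
    (hwp : Integrable (fun ω => |w ω| ^ p) μ) : Integrable w μ := by
  refine (hwp.add (integrable_const 1)).mono' hm.aestronglyMeasurable (ae_of_all _ fun ω => ?_)
  rw [Real.norm_eq_abs]
  rcases le_total |w ω| 1 with h | h
  · exact h.trans (le_add_of_nonneg_left (by positivity))
  · exact (Real.self_le_rpow_of_one_le h hp).trans (le_add_of_nonneg_right zero_le_one)

/-- Truncate at level `M`: the small part is controlled in `L²`, the large part in `L¹`. -/
lemma integral_abs_sum_eval_sub_le_three_mul (hm : Measurable w) (hp₁ : 1 ≤ p) (hp₂ : p ≤ 2)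
    (hwp : Integrable (fun ω => |w ω| ^ p) μ) {n : ℕ} (hM : 0 < M)
    (hMn : n * ∫ ω, |w ω| ^ p ∂μ ≤ M ^ p) :
    ∫ x, |∑ i, w (x i) - n * ∫ ω, w ω ∂μ| ∂iidLaw μ n ≤ 3 * M := by
  set S := {ω | |w ω| ≤ M}
  have hS : MeasurableSet S := measurableSet_le hm.abs measurable_const
  have hw := integrable_of_integrable_abs_rpow hm hp₁ hwp
  have hbound (ω : Ω) : ‖S.indicator w ω‖ ≤ M := by
    by_cases h : ω ∈ S
    · rwa [Set.indicator_of_mem h]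
    · rw [Set.indicator_of_notMem h, norm_zero]; exact hM.le
  have hsmall : MemLp (S.indicator w) 2 μ :=
    .of_bound (hm.indicator hS).aestronglyMeasurable M (ae_of_all _ hbound)
  have hsmall_sq : n * ∫ ω, S.indicator w ω ^ 2 ∂μ ≤ M ^ 2 := by
    calc n * ∫ ω, S.indicator w ω ^ 2 ∂μ ≤ n * (M ^ (2 - p) * ∫ ω, |w ω| ^ p ∂μ) := by
          gcongr; exact integral_sq_indicator_abs_le_le hM.le hp₂ hwp
      _ ≤ M ^ (2 - p) * M ^ p := by rw [mul_left_comm]; gcongr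
      _ = M ^ 2 := by rw [← Real.rpow_add hM, sub_add_cancel, Real.rpow_two]
  have hlarge_abs : n * ∫ ω, |Sᶜ.indicator w ω| ∂μ ≤ M := by
    calc n * ∫ ω, |Sᶜ.indicator w ω| ∂μ ≤ n * (M ^ (1 - p) * ∫ ω, |w ω| ^ p ∂μ) := by
          gcongr; exact integral_abs_indicator_compl_abs_le_le hM hp₁ hwp
      _ ≤ M ^ (1 - p) * M ^ p := by rw [mul_left_comm]; gcongr
      _ = M := by rw [← Real.rpow_add hM, sub_add_cancel, Real.rpow_one]
  calc ∫ x, |∑ i, w (x i) - n * ∫ ω, w ω ∂μ| ∂iidLaw μ n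
      = ∫ x, |∑ i, (S.indicator w (x i) + Sᶜ.indicator w (x i)) -
          n * ∫ ω, (S.indicator w ω + Sᶜ.indicator w ω) ∂μ| ∂iidLaw μ n := by
        simp_rw [Set.indicator_self_add_compl_apply]
    _ ≤ √(n * ∫ ω, S.indicator w ω ^ 2 ∂μ) + 2 * (n * ∫ ω, |Sᶜ.indicator w ω| ∂μ) :=
        (integral_abs_sum_eval_add_sub_le (hw.indicator hS) (hw.indicator hS.compl) n).trans
          (add_le_add (integral_abs_sum_eval_sub_le_sqrt hsmall n)
            (integral_abs_sum_eval_sub_le_two_mul (hw.indicator hS.compl) n))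
    _ ≤ M + 2 * M := by
        gcongr
        exact Real.sqrt_le_iff.2 ⟨hM.le, hsmall_sq⟩
    _ = 3 * M := by ring

theorem integral_abs_sum_eval_sub_le (hm : Measurable w) (hp₁ : 1 ≤ p) (hp₂ : p ≤ 2)
    (hwp : Integrable (fun ω => |w ω| ^ p) μ) (n : ℕ) :
    ∫ x, |∑ i, w (x i) - n * ∫ ω, w ω ∂μ| ∂iidLaw μ n ≤
      3 * (n * ∫ ω, |w ω| ^ p ∂μ) ^ p⁻¹ := by
  have hp₀ : 0 < p := by linarith
  have hA : 0 ≤ n * ∫ ω, |w ω| ^ p ∂μ := by positivity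
  refine (div_le_iff₀' three_pos).1 (le_of_forall_gt_imp_ge_of_dense fun M hM => ?_)
  have hM₀ : 0 < M := (Real.rpow_nonneg hA _).trans_lt hM
  refine (div_le_iff₀' three_pos).2
    (integral_abs_sum_eval_sub_le_three_mul hm hp₁ hp₂ hwp hM₀ ?_)
  exact (Real.rpow_inv_le_iff_of_pos hA hM₀.le hp₀).1 hM.le

lemma abs_sum_sub_mul_eq {n : ℕ} (hn : 0 < n) (S m : ℝ) : |S - n * m| = n * |S / n - m| := by
  have hn₀ : (n : ℝ) ≠ 0 := Nat.cast_ne_zero.2 hn.ne'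
  rw [← Nat.abs_cast, ← abs_mul, Nat.abs_cast]
  congr 1; field_simp

lemma lintegral_abs_average_sub_le (hm : Measurable w) (hp₁ : 1 ≤ p) (hp₂ : p ≤ 2)
    (hwp : Integrable (fun ω => |w ω| ^ p) μ) {n : ℕ} (hn : 0 < n) :
    ∫⁻ x, ENNReal.ofReal |(∑ i, w (x i)) / n - ∫ ω, w ω ∂μ| ∂iidLaw μ n ≤
      ENNReal.ofReal (3 * (∫ ω, |w ω| ^ p ∂μ) ^ p⁻¹ * (n : ℝ) ^ (-(1 - p⁻¹))) := by
  have hn₀ : (0 : ℝ) < n := Nat.cast_pos.2 hn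
  have hw := integrable_of_integrable_abs_rpow hm hp₁ hwp
  have hint : Integrable (fun x : Fin n → Ω => |(∑ i, w (x i)) / n - ∫ ω, w ω ∂μ|)
      (iidLaw μ n) := (((integrable_sum_eval hw n).div_const _).sub (integrable_const _)).abs
  rw [← ofReal_integral_eq_lintegral_ofReal hint (ae_of_all _ fun x => abs_nonneg _)]
  refine ENNReal.ofReal_le_ofReal ?_
  calc ∫ x, |(∑ i, w (x i)) / n - ∫ ω, w ω ∂μ| ∂iidLaw μ n
      = (n : ℝ)⁻¹ * ∫ x, |∑ i, w (x i) - n * ∫ ω, w ω ∂μ| ∂iidLaw μ n := by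
        simp_rw [abs_sum_sub_mul_eq hn, integral_const_mul, inv_mul_cancel_left₀ hn₀.ne']
    _ ≤ (n : ℝ)⁻¹ * (3 * (n * ∫ ω, |w ω| ^ p ∂μ) ^ p⁻¹) := by
        gcongr; exact integral_abs_sum_eval_sub_le hm hp₁ hp₂ hwp n
    _ = 3 * (∫ ω, |w ω| ^ p ∂μ) ^ p⁻¹ * (n : ℝ) ^ (-(1 - p⁻¹)) := by
        rw [Real.mul_rpow hn₀.le (by positivity), neg_sub, Real.rpow_sub_one hn₀.ne']
        ring

theorem withHighProbability_abs_sum_sub_le (hm : Measurable w) (hp₁ : 1 ≤ p) (hp₂ : p ≤ 2)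
    (hwp : Integrable (fun ω => |w ω| ^ p) μ) {γ : ℝ} (hγ : γ < 1 - p⁻¹) :
    WithHighProbability (iidLaw μ) fun n x =>
      |∑ i, w (x i) - n * ∫ ω, w ω ∂μ| ≤ (n : ℝ) ^ (1 - γ) := by
  have haverage := WithHighProbability.of_lintegral_le (μ := iidLaw μ)
    (fun n =>
      (((measurable_sum_eval hm n).div_const _).sub_const _).abs.ennreal_ofReal.aemeasurable) hγ
    ((eventually_gt_atTop 0).mono fun n hn => lintegral_abs_average_sub_le hm hp₁ hp₂ hwp hn)
  refine haverage.mono ((eventually_gt_atTop 0).mono fun n hn => ae_of_all _ fun x hx => ?_)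
  have hn₀ : (0 : ℝ) < n := Nat.cast_pos.2 hn
  rw [ENNReal.ofReal_le_ofReal_iff (by positivity)] at hx
  calc |∑ i, w (x i) - n * ∫ ω, w ω ∂μ| = n * |(∑ i, w (x i)) / n - ∫ ω, w ω ∂μ| :=
        abs_sum_sub_mul_eq hn _ _
    _ ≤ n * (n : ℝ) ^ (-γ) := by gcongr
    _ = (n : ℝ) ^ (1 - γ) := by rw [sub_eq_add_neg, Real.rpow_add hn₀, Real.rpow_one]

lemma measurePreserving_prefix (μ : Measure Ω) [IsProbabilityMeasure μ] (n : ℕ) :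
    MeasurePreserving (fun (ω : ℕ → Ω) (i : Fin n) => ω i) (Measure.infinitePi fun _ : ℕ => μ)
      (iidLaw μ n) :=
  ⟨by fun_prop, (Measure.map_infinitePi_infinitePi_of_inj Fin.val_injective).trans
    (Measure.infinitePi_eq_pi _)⟩

lemma ae_tendsto_average (hm : Measurable w) (hw : Integrable w μ) :
    ∀ᵐ ω ∂Measure.infinitePi fun _ : ℕ => μ,
      Tendsto (fun n : ℕ => (n : ℝ)⁻¹ • ∑ i ∈ Finset.range n, w (ω i)) atTop
        (𝓝 (∫ ω, w ω ∂μ)) := by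
  have hlaw (i : ℕ) := measurePreserving_eval_infinitePi (fun _ : ℕ => μ) i
  have hindep : iIndepFun (fun (i : ℕ) (ω : ℕ → Ω) => w (ω i)) (Measure.infinitePi fun _ => μ) :=
    iIndepFun_infinitePi fun _ => hm
  have hident (i : ℕ) : IdentDistrib (fun ω : ℕ → Ω => w (ω i)) (fun ω => w (ω 0))
      (Measure.infinitePi fun _ => μ) (Measure.infinitePi fun _ => μ) :=
    IdentDistrib.comp ⟨(hlaw i).aemeasurable, (hlaw 0).aemeasurable,
      (hlaw i).map_eq.trans (hlaw 0).map_eq.symm⟩ hm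
  have hmean : ∫ ω : ℕ → Ω, w (ω 0) ∂(Measure.infinitePi fun _ => μ) = ∫ ω, w ω ∂μ := by
    rw [← integral_map (hlaw 0).aemeasurable hm.aestronglyMeasurable, (hlaw 0).map_eq]
  have hlln := strong_law_ae (fun (i : ℕ) (ω : ℕ → Ω) => w (ω i))
    ((hlaw 0).integrable_comp_of_integrable hw) (fun i j hij => hindep.indepFun hij) hident
  rwa [hmean] at hlln

theorem withHighProbability_sum_le_mul (hm : Measurable w) (hw : Integrable w μ) {a : ℝ}
    (ha : ∫ ω, w ω ∂μ < a) :
    WithHighProbability (iidLaw μ) fun n x => ∑ i, w (x i) ≤ a * n := by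
  have hmeas (n : ℕ) : Measurable fun ω : ℕ → Ω => (n : ℝ)⁻¹ • ∑ i ∈ Finset.range n, w (ω i) :=
    (Finset.measurable_sum _ fun i _ => hm.comp (measurable_pi_apply i)).fun_const_smul _
  have hlim := tendstoInMeasure_of_tendsto_ae (fun n => (hmeas n).aestronglyMeasurable)
    (ae_tendsto_average hm hw) (ENNReal.ofReal (a - ∫ ω, w ω ∂μ)) (by simpa using ha)
  refine tendsto_of_tendsto_of_tendsto_of_le_of_le' tendsto_const_nhds hlim
    (Eventually.of_forall fun _ => zero_le) ?_
  filter_upwards [eventually_gt_atTop 0] with n hn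
  have hset : MeasurableSet {x : Fin n → Ω | ¬ ∑ i, w (x i) ≤ a * n} :=
    (measurableSet_le (measurable_sum_eval hm n) measurable_const).compl
  rw [← (measurePreserving_prefix μ n).measure_preimage hset.nullMeasurableSet]
  refine measure_mono fun ω hω => ?_
  have hlt : a * n < ∑ i ∈ Finset.range n, w (ω i) := by
    simpa [Finset.sum_range] using hω
  have hle : a ≤ (n : ℝ)⁻¹ • ∑ i ∈ Finset.range n, w (ω i) := by
    rw [smul_eq_mul, inv_mul_eq_div, le_div_iff₀ (Nat.cast_pos.2 hn)]
    exact hlt.le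
  rw [Set.mem_ofPred_eq, edist_dist, Real.dist_eq]
  exact ENNReal.ofReal_le_ofReal (le_abs.2 (Or.inl (sub_le_sub_right hle _)))

end Sums

/-! ### Weighted laws and their empirical counterparts -/

section WeightedLaw

variable {Ω : Type*}

/-- The finite measure `s ↦ E[1(X ∈ s) W]` on `ℕ`; with `W = 1` it is the law of `X`, and
normalizing it gives the law of `X` biased by `W`. -/
def weightedLaw [MeasurableSpace Ω] (μ : Measure Ω) (X W : Ω → ℕ) : Measure ℕ :=
  (μ.withDensity fun ω => (W ω : ℝ≥0∞)).map X

/-- The analogue of `weightedLaw` for the empirical distribution of the sample `x`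
(the zero measure if the sample is empty). -/
def empiricalLaw (X W : Ω → ℕ) {n : ℕ} (x : Fin n → Ω) : Measure ℕ :=
  (n : ℝ≥0∞)⁻¹ • ∑ r, (W (x r) : ℝ≥0∞) • Measure.dirac (X (x r))

/-- The contribution of `ω` to the mass that `weightedLaw` and `empiricalLaw` give to `[t, ∞)`. -/
def tailWeight (X W : Ω → ℕ) (t : ℕ) (ω : Ω) : ℝ := if t ≤ X ω then W ω else 0

variable {X W : Ω → ℕ}

lemma tailWeight_nonneg (t : ℕ) (ω : Ω) : 0 ≤ tailWeight X W t ω := by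
  unfold tailWeight; positivity

lemma tsum_ofReal_tailWeight (ω : Ω) :
    ∑' t, ENNReal.ofReal (tailWeight X W t ω) = ENNReal.ofReal ((X ω + 1) * W ω) := by
  have hsupp : ∀ t ∉ Finset.range (X ω + 1), ENNReal.ofReal (tailWeight X W t ω) = 0 := by
    intro t ht
    simp [tailWeight, show ¬ t ≤ X ω by simpa using ht]
  rw [tsum_eq_sum hsupp, Finset.sum_congr rfl fun t ht =>
    show ENNReal.ofReal (tailWeight X W t ω) = ENNReal.ofReal (W ω) by
      rw [tailWeight, if_pos (Nat.lt_succ_iff.1 (Finset.mem_range.1 ht))]]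
  rw [Finset.sum_const, Finset.card_range, nsmul_eq_mul, ENNReal.ofReal_mul (by positivity)]
  congr 1; norm_cast

lemma tailWeight_rpow_le {p q : ℝ} (hp : 0 < p) (hpq : p ≤ q) (t : ℕ) (ω : Ω) :
    tailWeight X W t ω ^ p ≤ ((t : ℝ) + 1) ^ (-q) * ((X ω + 1) * W ω : ℝ) ^ q := by
  by_cases h : t ≤ X ω ∧ 1 ≤ W ω
  · have hW : (1 : ℝ) ≤ W ω := Nat.one_le_cast.2 h.2
    have hratio : (1 : ℝ) ≤ (X ω + 1) / (t + 1) := by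
      rw [one_le_div (by positivity)]
      exact_mod_cast Nat.succ_le_succ h.1
    calc tailWeight X W t ω ^ p = (W ω : ℝ) ^ p := by rw [tailWeight, if_pos h.1]
      _ ≤ (W ω : ℝ) ^ q := Real.rpow_le_rpow_of_exponent_le hW hpq
      _ ≤ ((X ω + 1) / (t + 1) * W ω : ℝ) ^ q := by
        gcongr
        · linarith
        · exact le_mul_of_one_le_left (by positivity) hratio
      _ = ((t : ℝ) + 1) ^ (-q) * ((X ω + 1) * W ω : ℝ) ^ q := by
        rw [Real.rpow_neg (by positivity), ← Real.inv_rpow (by positivity),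
          ← Real.mul_rpow (by positivity) (by positivity)]
        congr 1; ring
  · have hzero : tailWeight X W t ω = 0 := by
      rw [tailWeight, ite_eq_right_iff]
      intro ht
      simpa [ht] using h
    rw [hzero, Real.zero_rpow hp.ne']
    positivity

lemma empiricalLaw_real_Ici (X W : Ω → ℕ) {n : ℕ} (x : Fin n → Ω) (t : ℕ) :
    (empiricalLaw X W x).real (Set.Ici t) = (∑ r, tailWeight X W t (x r)) / n := by
  have hmass (r : Fin n) : (W (x r) : ℝ≥0∞) * (Set.Ici t).indicator 1 (X (x r)) =
      ENNReal.ofReal (tailWeight X W t (x r)) := by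
    by_cases h : t ≤ X (x r) <;> simp [tailWeight, h]
  simp only [measureReal_def, empiricalLaw, Measure.smul_apply, Measure.finsetSum_apply,
    Measure.dirac_apply, smul_eq_mul, hmass]
  rw [← ENNReal.ofReal_sum_of_nonneg fun r _ => tailWeight_nonneg t (x r), ENNReal.toReal_mul,
    ENNReal.toReal_ofReal (Finset.sum_nonneg fun r _ => tailWeight_nonneg t (x r)),
    ENNReal.toReal_inv, ENNReal.toReal_natCast, div_eq_inv_mul]

instance (X W : Ω → ℕ) {n : ℕ} (x : Fin n → Ω) : IsFiniteMeasure (empiricalLaw X W x) := by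
  refine ⟨?_⟩
  rcases n.eq_zero_or_pos with rfl | hn
  · simp [empiricalLaw]
  · simp [empiricalLaw, Measure.finsetSum_apply, ENNReal.mul_lt_top_iff, hn]

variable [MeasurableSpace Ω] {μ : Measure Ω}

lemma measurable_tailWeight (hX : Measurable X) (hW : Measurable W) (t : ℕ) :
    Measurable (tailWeight X W t) :=
  Measurable.ite (measurableSet_le measurable_const hX) (measurable_from_top.comp hW)
    measurable_const

lemma weightedLaw_Ici (hX : Measurable X) (t : ℕ) :
    weightedLaw μ X W (Set.Ici t) = ∫⁻ ω, ENNReal.ofReal (tailWeight X W t ω) ∂μ := by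
  have hset : MeasurableSet (X ⁻¹' Set.Ici t) := hX measurableSet_Ici
  rw [weightedLaw, Measure.map_apply hX measurableSet_Ici, withDensity_apply _ hset,
    ← lintegral_indicator hset]
  refine lintegral_congr fun ω => ?_
  by_cases h : t ≤ X ω <;> simp [tailWeight, h]

lemma weightedLaw_real_Ici (hX : Measurable X) (hW : Measurable W) (t : ℕ) :
    (weightedLaw μ X W).real (Set.Ici t) = ∫ ω, tailWeight X W t ω ∂μ := by
  rw [measureReal_def, weightedLaw_Ici hX, integral_eq_lintegral_of_nonneg_ae
    (ae_of_all _ (tailWeight_nonneg t)) (measurable_tailWeight hX hW t).aestronglyMeasurable]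

lemma tsum_weightedLaw_Ici (hX : Measurable X) (hW : Measurable W) :
    ∑' t, weightedLaw μ X W (Set.Ici t) = ∫⁻ ω, ENNReal.ofReal ((X ω + 1) * W ω) ∂μ := by
  simp_rw [weightedLaw_Ici hX]
  rw [← lintegral_tsum fun t => (measurable_tailWeight hX hW t).ennreal_ofReal.aemeasurable]
  simp_rw [tsum_ofReal_tailWeight]

lemma measurable_tailDist_empiricalLaw (hX : Measurable X) (hW : Measurable W) (Q : Measure ℕ)
    (n : ℕ) : Measurable fun x : Fin n → Ω => tailDist (empiricalLaw X W x) Q := by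
  simp_rw [tailDist, empiricalLaw_real_Ici]
  exact Measurable.tsum fun t => (((measurable_sum_eval
    (measurable_tailWeight hX hW t) n).div_const _).sub_const _).abs.ennreal_ofReal

variable [IsProbabilityMeasure μ] {p q : ℝ}

lemma lintegral_abs_average_tailWeight_sub_le (hX : Measurable X) (hW : Measurable W)
    (hp₁ : 1 ≤ p) (hp₂ : p ≤ 2) (hpq : p ≤ q)
    (hint : Integrable (fun ω => ((X ω + 1) * W ω : ℝ) ^ q) μ) (t : ℕ) {n : ℕ} (hn : 0 < n) :
    ∫⁻ x, ENNReal.ofReal |(∑ r, tailWeight X W t (x r)) / n - ∫ ω, tailWeight X W t ω ∂μ|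
        ∂iidLaw μ n ≤
      ENNReal.ofReal (3 * (∫ ω, ((X ω + 1) * W ω : ℝ) ^ q ∂μ) ^ p⁻¹ * (n : ℝ) ^ (-(1 - p⁻¹)) *
        ((t : ℝ) + 1) ^ (-(q / p))) := by
  have hp₀ : 0 < p := by linarith
  have hm := measurable_tailWeight hX hW t
  have hbound (ω : Ω) : |tailWeight X W t ω| ^ p ≤
      ((t : ℝ) + 1) ^ (-q) * ((X ω + 1) * W ω : ℝ) ^ q := by
    rw [abs_of_nonneg (tailWeight_nonneg t ω)]
    exact tailWeight_rpow_le hp₀ hpq t ω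
  have hmoment : Integrable (fun ω => |tailWeight X W t ω| ^ p) μ := by
    refine (hint.const_mul (((t : ℝ) + 1) ^ (-q))).mono'
      (hm.abs.pow_const p).aestronglyMeasurable (ae_of_all _ fun ω => ?_)
    rw [Real.norm_of_nonneg (by positivity)]
    exact hbound ω
  refine (lintegral_abs_average_sub_le hm hp₁ hp₂ hmoment hn).trans
    (ENNReal.ofReal_le_ofReal ?_)
  have hA : 0 ≤ ∫ ω, ((X ω + 1) * W ω : ℝ) ^ q ∂μ := integral_nonneg fun ω => by positivity
  calc 3 * (∫ ω, |tailWeight X W t ω| ^ p ∂μ) ^ p⁻¹ * (n : ℝ) ^ (-(1 - p⁻¹))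
      ≤ 3 * (((t : ℝ) + 1) ^ (-q) * ∫ ω, ((X ω + 1) * W ω : ℝ) ^ q ∂μ) ^ p⁻¹ *
          (n : ℝ) ^ (-(1 - p⁻¹)) := by
        gcongr
        rw [← integral_const_mul]
        exact integral_mono hmoment (hint.const_mul _) hbound
    _ = _ := by
        rw [Real.mul_rpow (by positivity) hA, ← Real.rpow_mul (by positivity), neg_mul,
          ← div_eq_mul_inv]
        ring

lemma lintegral_tailDist_empiricalLaw_le (hX : Measurable X) (hW : Measurable W)
    (hp₁ : 1 ≤ p) (hp₂ : p ≤ 2) (hpq : p < q)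
    (hint : Integrable (fun ω => ((X ω + 1) * W ω : ℝ) ^ q) μ) {n : ℕ} (hn : 0 < n) :
    ∫⁻ x, tailDist (empiricalLaw X W x) (weightedLaw μ X W) ∂iidLaw μ n ≤
      ENNReal.ofReal ((3 * (∫ ω, ((X ω + 1) * W ω : ℝ) ^ q ∂μ) ^ p⁻¹ *
        ∑' t : ℕ, ((t : ℝ) + 1) ^ (-(q / p))) * (n : ℝ) ^ (-(1 - p⁻¹))) := by
  have hsum : Summable fun t : ℕ => ((t : ℝ) + 1) ^ (-(q / p)) := by
    have := (summable_nat_add_iff 1).2 (Real.summable_nat_rpow.2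
      (neg_lt_neg ((one_lt_div (by linarith)).2 hpq)))
    simpa using this
  simp_rw [tailDist, empiricalLaw_real_Ici, weightedLaw_real_Ici hX hW]
  rw [lintegral_tsum fun t => (((measurable_sum_eval
    (measurable_tailWeight hX hW t) n).div_const _).sub_const _).abs.ennreal_ofReal.aemeasurable]
  refine (ENNReal.tsum_le_tsum fun t =>
    lintegral_abs_average_tailWeight_sub_le hX hW hp₁ hp₂ hpq.le hint t hn).trans_eq ?_
  rw [← ENNReal.ofReal_tsum_of_nonneg (fun t => by positivity) (hsum.mul_left _), tsum_mul_left]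
  congr 1; ring

theorem withHighProbability_tailDist_empiricalLaw_le (hX : Measurable X) (hW : Measurable W)
    (hq₁ : 1 < q) (hq₂ : q ≤ 2) (hint : Integrable (fun ω => ((X ω + 1) * W ω : ℝ) ^ q) μ)
    {γ : ℝ} (hγ : γ < 1 - q⁻¹) :
    WithHighProbability (iidLaw μ) fun n x =>
      tailDist (empiricalLaw X W x) (weightedLaw μ X W) ≤ ENNReal.ofReal ((n : ℝ) ^ (-γ)) := by
  obtain ⟨r, hr, hrq⟩ := exists_between (max_lt (sub_pos.2 (inv_lt_one_of_one_lt₀ hq₁)) hγ)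
  have hr₀ := (le_max_left _ _).trans_lt hr
  have hrγ := (le_max_right _ _).trans_lt hr
  have hq₀ : 0 < q⁻¹ := by positivity
  have hr₁ : 0 < 1 - r := by linarith
  have hp₁ : 1 ≤ (1 - r)⁻¹ := (one_le_inv₀ hr₁).2 (by linarith)
  have hpq : (1 - r)⁻¹ < q := inv_lt_of_inv_lt₀ (by linarith) (by linarith)
  refine WithHighProbability.of_lintegral_le (b := 1 - ((1 - r)⁻¹)⁻¹)
    (fun n => (measurable_tailDist_empiricalLaw hX hW _ n).aemeasurable) ?_
    ((eventually_gt_atTop 0).mono fun n hn =>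
      lintegral_tailDist_empiricalLaw_le hX hW hp₁ (hpq.le.trans hq₂) hpq hint hn)
  rwa [inv_inv, sub_sub_cancel]

end WeightedLaw

section Modification

variable {Ω : Type*} {X W : Ω → ℕ}

lemma abs_sum_tailWeight_sub_le {n : ℕ} {x y : Fin n → Ω} {s : Finset (Fin n)}
    (hxy : ∀ r ∉ s, y r = x r) (t : ℕ) :
    |∑ r, tailWeight X W t (y r) - ∑ r, tailWeight X W t (x r)| ≤
      ∑ r ∈ s, (tailWeight X W t (y r) + tailWeight X W t (x r)) := by
  rw [← Finset.sum_sub_distrib, ← Finset.sum_subset s.subset_univ fun r _ hr => by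
    rw [hxy r hr, sub_self]]
  refine (Finset.abs_sum_le_sum_abs _ _).trans (Finset.sum_le_sum fun r _ => ?_)
  simpa only [abs_of_nonneg (tailWeight_nonneg _ _)] using
    abs_sub (tailWeight X W t (y r)) (tailWeight X W t (x r))

lemma tailDist_empiricalLaw_le {n : ℕ} {x y : Fin n → Ω} {s : Finset (Fin n)}
    (hxy : ∀ r ∉ s, y r = x r) :
    tailDist (empiricalLaw X W y) (empiricalLaw X W x) ≤ ENNReal.ofReal
      ((∑ r ∈ s, ((X (y r) + 1) * W (y r) + (X (x r) + 1) * W (x r) : ℝ)) / n) := by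
  have hterm (t : ℕ) : ENNReal.ofReal
        |(empiricalLaw X W y).real (Set.Ici t) - (empiricalLaw X W x).real (Set.Ici t)| ≤
      ENNReal.ofReal (n : ℝ)⁻¹ * ∑ r ∈ s, (ENNReal.ofReal (tailWeight X W t (y r)) +
        ENNReal.ofReal (tailWeight X W t (x r))) := by
    simp_rw [← ENNReal.ofReal_add (tailWeight_nonneg _ _) (tailWeight_nonneg _ _)]
    rw [← ENNReal.ofReal_sum_of_nonneg fun r _ =>
        add_nonneg (tailWeight_nonneg _ _) (tailWeight_nonneg _ _),
      ← ENNReal.ofReal_mul (by positivity), empiricalLaw_real_Ici, empiricalLaw_real_Ici,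
      ← sub_div, abs_div, Nat.abs_cast, div_eq_inv_mul]
    gcongr
    exact abs_sum_tailWeight_sub_le hxy t
  refine (ENNReal.tsum_le_tsum hterm).trans_eq ?_
  rw [ENNReal.tsum_mul_left, Summable.tsum_finsetSum fun _ _ => ENNReal.summable]
  simp_rw [ENNReal.tsum_add, tsum_ofReal_tailWeight]
  rw [div_eq_inv_mul, ENNReal.ofReal_mul (by positivity), ENNReal.ofReal_sum_of_nonneg
    fun r _ => by positivity]
  congr 1
  exact Finset.sum_congr rfl fun r _ => (ENNReal.ofReal_add (by positivity) (by positivity)).symm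

end Modification

/-! ### Degree distributions as normalized laws -/

section NormalizedLaw

variable {Ω : Type*} {X W : Ω → ℕ}

lemma normalizedLaw_empiricalLaw (X W : Ω → ℕ) {n : ℕ} (x : Fin n → Ω) :
    normalizedLaw (empiricalLaw X W x) = ofMass fun t =>
      (∑ r, if X (x r) = t then (W (x r) : ℝ≥0∞) else 0) / ∑ r, (W (x r) : ℝ≥0∞) := by
  set S : Measure ℕ := ∑ r, (W (x r) : ℝ≥0∞) • Measure.dirac (X (x r))
  have hS : S Set.univ = ∑ r, (W (x r) : ℝ≥0∞) := by simp [S, Measure.finsetSum_apply]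
  have hnormalize : (empiricalLaw X W x Set.univ)⁻¹ • empiricalLaw X W x = (S Set.univ)⁻¹ • S := by
    rcases n.eq_zero_or_pos with rfl | hn
    · simp [empiricalLaw, S]
    have hn₀ : (n : ℝ≥0∞)⁻¹ ≠ 0 := by simp
    have hn₁ : (n : ℝ≥0∞)⁻¹ ≠ ∞ := by simpa using hn.ne'
    rw [empiricalLaw, Measure.smul_apply, smul_eq_mul, smul_smul,
      ENNReal.mul_inv (.inl hn₀) (.inl hn₁), mul_right_comm, ENNReal.inv_mul_cancel hn₀ hn₁,
      one_mul]
  ext s hs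
  have hatom (r : Fin n) : ∑' t : ℕ, (if X (x r) = t then (W (x r) : ℝ≥0∞) else 0) *
      s.indicator 1 (t : ℝ) = W (x r) * s.indicator 1 (X (x r) : ℝ) := by simp [ite_mul]
  rw [normalizedLaw, hnormalize, hS, Measure.map_apply (by fun_prop) hs, ofMass,
    Measure.sum_apply _ hs]
  simp only [Measure.smul_apply, smul_eq_mul, Measure.dirac_apply' _ hs, S,
    Measure.finsetSum_apply, div_eq_mul_inv, mul_right_comm _ _ (s.indicator _ _)]
  rw [ENNReal.tsum_mul_right]
  simp_rw [Finset.sum_mul]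
  rw [Summable.tsum_finsetSum fun _ _ => ENNReal.summable, mul_comm]
  simp only [hatom, Measure.dirac_apply]
  rfl

variable [MeasurableSpace Ω] {μ : Measure Ω}

lemma weightedLaw_univ (hX : Measurable X) (hint : Integrable (fun ω => (W ω : ℝ)) μ) :
    weightedLaw μ X W Set.univ = ENNReal.ofReal (∫ ω, (W ω : ℝ) ∂μ) := by
  rw [weightedLaw, Measure.map_apply hX .univ, Set.preimage_univ,
    withDensity_apply _ .univ, Measure.restrict_univ,
    ofReal_integral_eq_lintegral_ofReal hint (ae_of_all _ fun _ => by positivity)]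
  simp

lemma normalizedLaw_weightedLaw (hX : Measurable X) (hW : Measurable W)
    (hint : Integrable (fun ω => (W ω : ℝ)) μ) (hpos : 0 < ∫ ω, (W ω : ℝ) ∂μ) :
    normalizedLaw (weightedLaw μ X W) =
      (μ.withDensity fun ω => ENNReal.ofReal ((W ω : ℝ) / ∫ ω, (W ω : ℝ) ∂μ)).map
        fun ω => (X ω : ℝ) := by
  have hW' : Measurable fun ω => (W ω : ℝ≥0∞) := measurable_from_top.comp hW
  have hdensity : (fun ω => ENNReal.ofReal ((W ω : ℝ) / ∫ ω, (W ω : ℝ) ∂μ)) =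
      (ENNReal.ofReal (∫ ω, (W ω : ℝ) ∂μ))⁻¹ • fun ω => (W ω : ℝ≥0∞) := by
    ext ω
    rw [ENNReal.ofReal_div_of_pos hpos, ENNReal.ofReal_natCast, Pi.smul_apply, smul_eq_mul,
      ENNReal.div_eq_inv_mul]
  rw [normalizedLaw, weightedLaw_univ hX hint, hdensity,
    withDensity_smul _ hW', weightedLaw, ← Measure.map_smul,
    Measure.map_map (by fun_prop) hX]
  rfl

end NormalizedLaw

section DegreeLaws

variable {n : ℕ} (d : Fin n → ℕ × ℕ)

lemma ofMass_gMinus :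
    ofMass (gMinus d) = normalizedLaw (empiricalLaw Prod.fst (fun _ => 1) d) := by
  rw [normalizedLaw_empiricalLaw]
  congr with t
  simp [gMinus]

lemma ofMass_gPlus :
    ofMass (gPlus d) = normalizedLaw (empiricalLaw Prod.snd (fun _ => 1) d) := by
  rw [normalizedLaw_empiricalLaw]
  congr with t
  simp [gPlus]

lemma ofMass_fPlus : ofMass (fPlus d) = normalizedLaw (empiricalLaw Prod.snd Prod.fst d) := by
  rw [normalizedLaw_empiricalLaw]
  congr with t
  simp [fPlus, edges]

lemma ofMass_fMinus {d : Fin n → ℕ × ℕ} (hd : ∑ r, (d r).1 = ∑ r, (d r).2) :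
    ofMass (fMinus d) = normalizedLaw (empiricalLaw Prod.fst Prod.snd d) := by
  rw [normalizedLaw_empiricalLaw]
  congr with t
  simp [fMinus, edges, hd]

variable (G : Measure (ℕ × ℕ))

lemma limGMinus_eq [IsProbabilityMeasure G] :
    limGMinus G = normalizedLaw (weightedLaw G Prod.fst fun _ => 1) := by
  rw [normalizedLaw_weightedLaw measurable_fst measurable_const (by simp) (by simp)]
  simp [limGMinus]

lemma limGPlus_eq [IsProbabilityMeasure G] :
    limGPlus G = normalizedLaw (weightedLaw G Prod.snd fun _ => 1) := by
  rw [normalizedLaw_weightedLaw measurable_snd measurable_const (by simp) (by simp)]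
  simp [limGPlus]

variable {G}

lemma limFMinus_eq (hint : Integrable (fun p : ℕ × ℕ => (p.2 : ℝ)) G)
    (hpos : 0 < ∫ p, (p.2 : ℝ) ∂G) :
    limFMinus G = normalizedLaw (weightedLaw G Prod.fst Prod.snd) :=
  (normalizedLaw_weightedLaw measurable_fst measurable_snd hint hpos).symm

lemma limFPlus_eq (hint : Integrable (fun p : ℕ × ℕ => (p.1 : ℝ)) G)
    (hmean : ∫ p, (p.1 : ℝ) ∂G = ∫ p, (p.2 : ℝ) ∂G) (hpos : 0 < ∫ p, (p.2 : ℝ) ∂G) :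
    limFPlus G = normalizedLaw (weightedLaw G Prod.snd Prod.fst) := by
  rw [normalizedLaw_weightedLaw measurable_snd measurable_fst hint (hmean ▸ hpos), hmean]
  rfl

end DegreeLaws

lemma eventually_d₁_normalizedLaw_le {Q : Measure ℕ} [IsFiniteMeasure Q] [NeZero Q]
    (hmean : ∑' t, Q (Set.Ici t) ≠ ∞) {C ε η : ℝ} (hC : 0 ≤ C) (hη : 0 < η) (hεη : ε < η) :
    ∀ᶠ n : ℕ in atTop, ∀ P : Measure ℕ, IsFiniteMeasure P →
      tailDist P Q ≤ ENNReal.ofReal (C * (n : ℝ) ^ (-η)) →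
        d₁ (normalizedLaw P) (normalizedLaw Q) ≤ ENNReal.ofReal ((n : ℝ) ^ (-ε)) := by
  obtain ⟨B, hB⟩ := exists_d₁_normalizedLaw_le Q hmean
  have hsmall : Tendsto (fun n : ℕ => C * (n : ℝ) ^ (-η)) atTop (𝓝 0) := by
    simpa using ((tendsto_rpow_neg_atTop hη).comp tendsto_natCast_atTop_atTop).const_mul C
  filter_upwards [hsmall.eventually_le_const (half_pos (measureReal_univ_pos (μ := Q))),
    eventually_const_mul_rpow_neg_le (B * C) hεη] with n hn hBC P hP hPQ
  refine (hB P hP _ hn (by positivity) hPQ).trans (ENNReal.ofReal_le_ofReal ?_)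
  rwa [← mul_assoc]

/-! ### The correction step -/

/-- The quantity dominating all the moments involved: it is integrable under the assumptions on the
degrees, and it changes by at most a constant factor when a degree is increased by one. -/
def envelope (q : ℝ) (p : ℕ × ℕ) : ℝ := (((p.1 : ℝ) + 1) * ((p.2 : ℝ) + 1)) ^ q

/-- The summand `((D⁻)^κ + (D⁺)^κ) D⁺ D⁻` of the moment condition defining `Ω_n`. -/
def momentTerm (κ : ℝ) (p : ℕ × ℕ) : ℝ := ((p.1 : ℝ) ^ κ + (p.2 : ℝ) ^ κ) * p.2 * p.1

/-- The pairs (value, weight) of functions of the degrees whose weighted laws are controlled by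
`envelope`; those needed are `(𝒟^±, 1)` for `G^±` and `(𝒟^±, 𝒟^∓)` for `F^±`. -/
def IsAdmissible (X W : ℕ × ℕ → ℕ) : Prop :=
  ∀ p, (X p + 1) * W p ≤ (p.1 + 1) * (p.2 + 1)

lemma isAdmissible_fst_one : IsAdmissible Prod.fst fun _ => 1 := fun p => by nlinarith

lemma isAdmissible_snd_one : IsAdmissible Prod.snd fun _ => 1 := fun p => by nlinarith

lemma isAdmissible_fst_snd : IsAdmissible Prod.fst Prod.snd := fun p => by nlinarith

lemma isAdmissible_snd_fst : IsAdmissible Prod.snd Prod.fst := fun p => by nlinarith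

section Envelope

variable {κ q : ℝ}

lemma envelope_nonneg (q : ℝ) (p : ℕ × ℕ) : 0 ≤ envelope q p := by
  unfold envelope; positivity

lemma one_le_add_one_mul_add_one (p : ℕ × ℕ) : 1 ≤ ((p.1 : ℝ) + 1) * ((p.2 : ℝ) + 1) := by
  nlinarith [p.1.cast_nonneg (α := ℝ), p.2.cast_nonneg (α := ℝ)]

lemma envelope_le_of_le_add_one (hq : 0 ≤ q) {p p' : ℕ × ℕ} (h : p' ≤ p + 1) :
    envelope q p' ≤ 4 ^ q * envelope q p := by
  have h₁ : (p'.1 : ℝ) ≤ p.1 + 1 := mod_cast h.1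
  have h₂ : (p'.2 : ℝ) ≤ p.2 + 1 := mod_cast h.2
  rw [envelope, envelope, ← Real.mul_rpow (by positivity) (by positivity)]
  refine Real.rpow_le_rpow (by positivity) ?_ hq
  calc ((p'.1 : ℝ) + 1) * ((p'.2 : ℝ) + 1) ≤ (2 * (p.1 + 1)) * (2 * (p.2 + 1)) := by
        gcongr <;> linarith [p.1.cast_nonneg (α := ℝ), p.2.cast_nonneg (α := ℝ)]
    _ = 4 * ((p.1 + 1) * (p.2 + 1)) := by ring

lemma momentTerm_nonneg (κ : ℝ) (p : ℕ × ℕ) : 0 ≤ momentTerm κ p := by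
  unfold momentTerm; positivity

lemma momentTerm_le_envelope (hκ : 0 ≤ κ) (p : ℕ × ℕ) :
    momentTerm κ p ≤ 2 * envelope (1 + κ) p := by
  set E := ((p.1 : ℝ) + 1) * ((p.2 : ℝ) + 1)
  have hE : 0 < E := by positivity
  have hfst : (p.1 : ℝ) ≤ E := by
    nlinarith [p.1.cast_nonneg (α := ℝ), p.2.cast_nonneg (α := ℝ)]
  have hsnd : (p.2 : ℝ) ≤ E := by
    nlinarith [p.1.cast_nonneg (α := ℝ), p.2.cast_nonneg (α := ℝ)]
  have hmul : (p.2 * p.1 : ℝ) ≤ E := by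
    nlinarith [p.1.cast_nonneg (α := ℝ), p.2.cast_nonneg (α := ℝ)]
  calc momentTerm κ p = ((p.1 : ℝ) ^ κ + (p.2 : ℝ) ^ κ) * (p.2 * p.1) := mul_assoc _ _ _
    _ ≤ (E ^ κ + E ^ κ) * E := by gcongr
    _ = 2 * envelope (1 + κ) p := by
      rw [envelope, Real.rpow_one_add' hE.le (by linarith)]; ring

lemma momentTerm_eq (hκ : 0 < κ) (p : ℕ × ℕ) :
    momentTerm κ p = (p.1 : ℝ) ^ (1 + κ) * (p.2 : ℝ) + (p.1 : ℝ) * (p.2 : ℝ) ^ (1 + κ) := by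
  rw [momentTerm, Real.rpow_one_add' p.1.cast_nonneg (by linarith),
    Real.rpow_one_add' p.2.cast_nonneg (by linarith)]
  ring

lemma envelope_le (hq : 0 ≤ q) (p : ℕ × ℕ) :
    envelope q p ≤
      4 ^ q * ((p.1 : ℝ) ^ q * (p.2 : ℝ) ^ q + |(p.1 : ℝ) - (p.2 : ℝ)| ^ q + 1) := by
  set m := max ((p.1 : ℝ) * p.2) (max |(p.1 : ℝ) - p.2| 1)
  have hm : ((p.1 : ℝ) + 1) * ((p.2 : ℝ) + 1) ≤ 4 * m := by
    have h₁ : (p.1 : ℝ) * p.2 ≤ m := le_max_left _ _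
    have h₂ : |(p.1 : ℝ) - p.2| ≤ m := (le_max_left _ _).trans (le_max_right _ _)
    have h₃ : 1 ≤ m := (le_max_right _ _).trans (le_max_right _ _)
    rcases p with ⟨_ | a, _ | b⟩ <;> push_cast at h₁ h₂ ⊢
    · linarith
    · linarith [neg_le_abs ((0 : ℝ) - (b + 1))]
    · linarith [le_abs_self ((a : ℝ) + 1 - 0)]
    · nlinarith [a.cast_nonneg (α := ℝ), b.cast_nonneg (α := ℝ)]
  have hm₀ : 0 ≤ m := le_max_of_le_left (by positivity)
  have hmq : m ^ q ≤ (p.1 : ℝ) ^ q * (p.2 : ℝ) ^ q + |(p.1 : ℝ) - (p.2 : ℝ)| ^ q + 1 := by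
    have h₁ : 0 ≤ (p.1 : ℝ) ^ q * (p.2 : ℝ) ^ q := by positivity
    have h₂ : 0 ≤ |(p.1 : ℝ) - (p.2 : ℝ)| ^ q := by positivity
    rcases max_choice ((p.1 : ℝ) * p.2) (max |(p.1 : ℝ) - p.2| 1) with h | h
    · rw [show m = _ from h, Real.mul_rpow (by positivity) (by positivity)]
      linarith
    · rcases max_choice |(p.1 : ℝ) - p.2| 1 with h' | h'
      · rw [show m = _ from h.trans h']; linarith
      · rw [show m = _ from h.trans h', Real.one_rpow]; linarith
  calc envelope q p ≤ (4 * m) ^ q := by unfold envelope; gcongr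
    _ = 4 ^ q * m ^ q := Real.mul_rpow (by norm_num) hm₀
    _ ≤ _ := by gcongr

end Envelope

section Integrability

variable {G : Measure (ℕ × ℕ)} {κ q : ℝ} {X W : ℕ × ℕ → ℕ}

lemma integrable_of_nonneg_of_le {f g : ℕ × ℕ → ℝ} (hg : Integrable g G) (hf : ∀ p, 0 ≤ f p)
    (hfg : ∀ p, f p ≤ g p) : Integrable f G :=
  hg.mono' .of_discrete (ae_of_all _ fun p => by rw [Real.norm_of_nonneg (hf p)]; exact hfg p)

lemma integrable_envelope [IsFiniteMeasure G] (hq : 0 ≤ q)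
    (hdiff : Integrable (fun p : ℕ × ℕ => |(p.1 : ℝ) - (p.2 : ℝ)| ^ q) G)
    (hprod : Integrable (fun p : ℕ × ℕ => (p.1 : ℝ) ^ q * (p.2 : ℝ) ^ q) G) :
    Integrable (envelope q) G :=
  integrable_of_nonneg_of_le (((hprod.add hdiff).add (integrable_const 1)).const_mul (4 ^ q))
    (envelope_nonneg q) (envelope_le hq)

lemma integrable_momentTerm (hκ : 0 ≤ κ) (hG : Integrable (envelope (1 + κ)) G) :
    Integrable (momentTerm κ) G :=
  integrable_of_nonneg_of_le (hG.const_mul 2) (momentTerm_nonneg κ) (momentTerm_le_envelope hκ)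

namespace IsAdmissible

lemma rpow_le_envelope (h : IsAdmissible X W) (hq : 0 ≤ q) (p : ℕ × ℕ) :
    ((X p + 1) * W p : ℝ) ^ q ≤ envelope q p :=
  Real.rpow_le_rpow (by positivity) (mod_cast h p) hq

lemma le_envelope (h : IsAdmissible X W) (hq : 1 ≤ q) (p : ℕ × ℕ) :
    ((X p + 1) * W p : ℝ) ≤ envelope q p :=
  calc ((X p + 1) * W p : ℝ) ≤ ((p.1 : ℝ) + 1) * ((p.2 : ℝ) + 1) := mod_cast h p
    _ ≤ envelope q p := Real.self_le_rpow_of_one_le (one_le_add_one_mul_add_one p) hq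

lemma integrable_rpow (h : IsAdmissible X W) (hq : 0 ≤ q) (hG : Integrable (envelope q) G) :
    Integrable (fun p => ((X p + 1) * W p : ℝ) ^ q) G :=
  integrable_of_nonneg_of_le hG (fun _ => by positivity) (h.rpow_le_envelope hq)

lemma integrable (h : IsAdmissible X W) (hq : 1 ≤ q) (hG : Integrable (envelope q) G) :
    Integrable (fun p => ((X p + 1) * W p : ℝ)) G :=
  integrable_of_nonneg_of_le hG (fun _ => by positivity) (h.le_envelope hq)

lemma integrable_weight (h : IsAdmissible X W) (hq : 1 ≤ q) (hG : Integrable (envelope q) G) :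
    Integrable (fun p => (W p : ℝ)) G :=
  integrable_of_nonneg_of_le (h.integrable hq hG) (fun _ => by positivity) fun p =>
    le_mul_of_one_le_left (by positivity) (by linarith [(X p).cast_nonneg (α := ℝ)])

end IsAdmissible

end Integrability

section Corrected

variable {n : ℕ} {x : Fin n → ℕ × ℕ} {s : Finset (Fin n)} {κ q : ℝ} {X W : ℕ × ℕ → ℕ}

lemma corrected_le_add_one (r : Fin n) : corrected x s r ≤ x r + 1 := by
  constructor <;> simp only [corrected] <;> split_ifs <;> simp

lemma corrected_of_notMem {r : Fin n} (hr : r ∉ s) : corrected x s r = x r := by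
  simp [corrected, hr]

lemma sum_corrected_eq (hs : s.card = (imbalance x).natAbs) :
    ∑ r, (corrected x s r).1 = ∑ r, (corrected x s r).2 := by
  have himbalance : imbalance x = ((∑ r, (x r).1 : ℕ) : ℤ) - ((∑ r, (x r).2 : ℕ) : ℤ) := by
    simp [imbalance, Finset.sum_sub_distrib]
  rcases le_or_gt (imbalance x) 0 with h | h
  · simp only [corrected, h, not_lt.2 h, true_and, false_and, if_false, add_zero,
      Finset.sum_add_distrib, Finset.sum_boole, Finset.filter_univ_mem, Nat.cast_id]
    omega
  · simp only [corrected, h, not_le.2 h, true_and, false_and, if_false, add_zero,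
      Finset.sum_add_distrib, Finset.sum_boole, Finset.filter_univ_mem, Nat.cast_id]
    omega

lemma tailDist_corrected_le (h : IsAdmissible X W) (hq : 1 ≤ q) :
    tailDist (empiricalLaw X W (corrected x s)) (empiricalLaw X W x) ≤
      ENNReal.ofReal (2 * 4 ^ q * ((∑ r ∈ s, envelope q (x r)) / n)) := by
  refine (tailDist_empiricalLaw_le fun r hr => corrected_of_notMem hr).trans
    (ENNReal.ofReal_le_ofReal ?_)
  rw [← mul_div_assoc, Finset.mul_sum]
  gcongr with r
  have hbefore := (h.le_envelope hq (x r)).trans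
    (envelope_le_of_le_add_one (by linarith) (le_add_of_nonneg_right zero_le_one))
  have hafter := (h.le_envelope hq (corrected x s r)).trans
    (envelope_le_of_le_add_one (by linarith) (corrected_le_add_one r))
  linarith

lemma sum_momentTerm_corrected_le (hκ : 0 ≤ κ) :
    ∑ r, momentTerm κ (corrected x s r) ≤
      ∑ r, momentTerm κ (x r) + 2 * 4 ^ (1 + κ) * ∑ r ∈ s, envelope (1 + κ) (x r) := by
  have hterm (r : Fin n) : momentTerm κ (corrected x s r) ≤
      momentTerm κ (x r) + if r ∈ s then 2 * 4 ^ (1 + κ) * envelope (1 + κ) (x r) else 0 := by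
    split_ifs with hr
    · have hchange := envelope_le_of_le_add_one (q := 1 + κ) (by linarith)
        (corrected_le_add_one (x := x) (s := s) r)
      linarith [momentTerm_le_envelope hκ (corrected x s r), momentTerm_nonneg κ (x r)]
    · rw [corrected_of_notMem hr, add_zero]
  refine (Finset.sum_le_sum fun r _ => hterm r).trans_eq ?_
  rw [Finset.sum_add_distrib, Finset.sum_ite_mem, Finset.univ_inter, Finset.mul_sum]

end Corrected

/-! ### A uniformly random set of given size -/

section RandomSubset

variable {ι : Type*} [Fintype ι] {k : ℕ}

lemma card_mul_card_filter_mem_powersetCard [DecidableEq ι] (k : ℕ) (i : ι) :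
    Fintype.card ι * (Finset.univ.powersetCard k |>.filter fun s : Finset ι => i ∈ s).card =
      k * (Finset.univ.powersetCard k : Finset (Finset ι)).card := by
  obtain ⟨m, hm⟩ := Nat.exists_eq_succ_of_ne_zero (Fintype.card_pos_iff.2 ⟨i⟩).ne'
  rcases k with _ | k
  · simp
  · have hcount := Finset.card_filter_powersetCard_subset {i} (Finset.univ : Finset ι) (k + 1)
      (Finset.subset_univ _) (by simp)
    simp only [Finset.singleton_subset_iff, Finset.card_singleton, Finset.card_univ, hm,
      Nat.add_sub_cancel, Nat.succ_eq_add_one] at hcount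
    rw [hcount, Finset.card_powersetCard, Finset.card_univ, hm, Nat.succ_eq_add_one,
      Nat.add_one_mul_choose_eq, mul_comm]

lemma lintegral_sum_uniformOn_card_eq (hk : k ≤ Fintype.card ι) (a : ι → ℝ≥0∞) :
    ∫⁻ s, ∑ i ∈ s, a i ∂uniformOn {s : Finset ι | s.card = k} =
      (k : ℝ≥0∞) / Fintype.card ι * ∑ i, a i := by
  classical
  set P : Finset (Finset ι) := Finset.univ.powersetCard k with hP
  have hset : {s : Finset ι | s.card = k} = (P : Set (Finset ι)) := by ext s; simp [hP]
  have hPcard : (P.card : ℝ≥0∞) ≠ 0 := by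
    simpa [hP] using (Nat.choose_pos hk).ne'
  calc ∫⁻ s, ∑ i ∈ s, a i ∂uniformOn {s : Finset ι | s.card = k}
      = (P.card : ℝ≥0∞)⁻¹ * ∑ s ∈ P, ∑ i ∈ s, a i := by
        simp only [hset, uniformOn, ProbabilityTheory.cond, lintegral_smul_measure,
          lintegral_finset, Measure.count_singleton, mul_one, Measure.count_apply_finset,
          smul_eq_mul]
    _ = (P.card : ℝ≥0∞)⁻¹ * ∑ i, (P.filter fun s => i ∈ s).card * a i := by
        rw [Finset.sum_comm' (t' := Finset.univ) (s' := fun i => P.filter fun s => i ∈ s)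
          (by simp)]
        simp only [Finset.sum_const, nsmul_eq_mul]
    _ = (k : ℝ≥0∞) / Fintype.card ι * ∑ i, a i := by
        rw [Finset.mul_sum, Finset.mul_sum]
        refine Finset.sum_congr rfl fun i _ => ?_
        have hι : (Fintype.card ι : ℝ≥0∞) ≠ 0 :=
          Nat.cast_ne_zero.2 (Fintype.card_pos_iff.2 ⟨i⟩).ne'
        have hcount : (Fintype.card ι : ℝ≥0∞) * (P.filter fun s => i ∈ s).card = k * P.card :=
          mod_cast card_mul_card_filter_mem_powersetCard k i
        rw [← mul_assoc, ← ENNReal.div_eq_inv_mul]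
        congr 1
        rwa [ENNReal.div_eq_div_iff hι (by simp) hPcard (by simp), mul_comm (P.card : ℝ≥0∞)]

end RandomSubset

/-! ### The accepted sample and the selected nodes -/

section Algorithm

variable {G : Measure (ℕ × ℕ)} [IsProbabilityMeasure G] {δ : ℝ} {n : ℕ}

instance : IsProbabilityMeasure (roundsLaw G n) := by
  unfold roundsLaw; infer_instance

lemma isProbabilityMeasure_algorithmLaw (hδ : 0 ≤ δ) (n : ℕ) :
    IsProbabilityMeasure (algorithmLaw G δ n) := by
  have := isMarkovKernel_selection hδ n
  unfold algorithmLaw; infer_instance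

lemma measurePreserving_firstRound (hδ : 0 ≤ δ) (n : ℕ) :
    MeasurePreserving (fun ω => ω.1 0) (algorithmLaw G δ n) (iidLaw G n) := by
  have := isMarkovKernel_selection hδ n
  have hfst : MeasurePreserving Prod.fst (algorithmLaw G δ n) (roundsLaw G n) :=
    ⟨measurable_fst, Measure.fst_compProd _ _⟩
  exact (measurePreserving_eval_infinitePi (fun _ : ℕ => iidLaw G n) 0).comp hfst

lemma accepted_eq_of_accept {ω : Rounds n} (h : Accept δ (ω 0)) : accepted δ ω = ω 0 := by
  classical
  have hT : Terminates δ ω := ⟨0, h⟩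
  rw [accepted, dif_pos hT]
  exact congrArg ω ((Nat.find_eq_zero hT).2 h)

lemma accept_accepted (δ : ℝ) (ω : Rounds n) : Accept δ (accepted δ ω) := by
  classical
  by_cases h : Terminates δ ω
  · rw [accepted, dif_pos h]
    exact Nat.find_spec h
  · simp only [accepted, h, dite_false, Accept, imbalance, Pi.zero_apply, Prod.fst_zero,
      Prod.snd_zero, sub_self, Finset.sum_const_zero, abs_zero, Int.cast_zero]
    positivity

lemma withHighProbability_accept {p : ℝ} (hp₁ : 1 ≤ p) (hp₂ : p ≤ 2)
    (hdiff : Integrable (fun p' : ℕ × ℕ => |(p'.1 : ℝ) - (p'.2 : ℝ)| ^ p) G)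
    (hmean : ∫ p', ((p'.1 : ℝ) - (p'.2 : ℝ)) ∂G = 0) (hδ : δ < 1 - p⁻¹) :
    WithHighProbability (iidLaw G) fun _ x => Accept δ x :=
  (withHighProbability_abs_sum_sub_le .of_discrete hp₁ hp₂ hdiff hδ).mono <|
    Eventually.of_forall fun _ => ae_of_all _ fun _ hx => by
      simpa [hmean, Accept, imbalance] using hx

/-- The first round is accepted with high probability, so that conditioning on acceptance does not
affect what holds with high probability for an i.i.d. sample. -/
lemma withHighProbability_accepted (hδ : 0 ≤ δ)
    (haccept : WithHighProbability (iidLaw G) fun _ x => Accept δ x)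
    {P : ∀ n, (Fin n → ℕ × ℕ) → Prop} (hP : WithHighProbability (iidLaw G) P) :
    WithHighProbability (algorithmLaw G δ) fun n ω =>
      Terminates δ ω.1 ∧ P n (accepted δ ω.1) :=
  ((haccept.and hP).comp_measurePreserving (measurePreserving_firstRound hδ)).mono <|
    Eventually.of_forall fun _ => ae_of_all _ fun _ hω =>
      ⟨⟨0, hω.1⟩, (accepted_eq_of_accept hω.1).symm ▸ hω.2⟩

lemma measurable_accepted_prodMk (δ : ℝ) (n : ℕ) :
    Measurable fun ω : Rounds n × Finset (Fin n) => (accepted δ ω.1, ω.2) :=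
  ((measurable_accepted δ n).comp measurable_fst).prodMk measurable_snd

lemma ae_card_selected_eq (hδ : 0 ≤ δ) (n : ℕ) :
    ∀ᵐ ω ∂algorithmLaw G δ n, ω.2.card = (imbalance (accepted δ ω.1)).natAbs := by
  have := isMarkovKernel_selection hδ n
  refine Measure.ae_compProd_of_ae_ae ?_ (ae_of_all _ fun ω => ?_)
  · exact measurable_accepted_prodMk δ n (MeasurableSet.of_discrete
      (s := {z : (Fin n → ℕ × ℕ) × Finset (Fin n) | z.2.card = (imbalance z.1).natAbs}))
  · exact ae_cond_mem (Set.toFinite _).measurableSet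

lemma lintegral_selection_average_le (hδ : 0 ≤ δ) (hn : 0 < n) {a : Fin n → ℝ} (ha : ∀ r, 0 ≤ a r)
    {C : ℝ} (hC : ∑ r, a r ≤ C * n) (ω : Rounds n) :
    ∫⁻ s, ENNReal.ofReal ((∑ r ∈ s, a r) / n) ∂selection δ n ω ≤
      ENNReal.ofReal (C * (n : ℝ) ^ (-δ)) := by
  have hn' : (0 : ℝ) < n := Nat.cast_pos.2 hn
  set k := (imbalance (accepted δ ω)).natAbs with hk
  have hkn : (k : ℝ) / n ≤ (n : ℝ) ^ (-δ) := by
    have hacc : (k : ℝ) ≤ (n : ℝ) ^ (1 - δ) := by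
      rw [hk, Nat.cast_natAbs]; exact accept_accepted δ ω
    rwa [div_le_iff₀ hn', ← Real.rpow_add_one hn'.ne', neg_add_eq_sub]
  have haverage : (∑ r, a r) / n ≤ C := (div_le_iff₀ hn').2 hC
  have haverage₀ : 0 ≤ (∑ r, a r) / n :=
    div_nonneg (Finset.sum_nonneg fun r _ => ha r) hn'.le
  calc ∫⁻ s, ENNReal.ofReal ((∑ r ∈ s, a r) / n) ∂selection δ n ω
      = ∫⁻ s, ∑ r ∈ s, ENNReal.ofReal (a r / n)
          ∂uniformOn {s : Finset (Fin n) | s.card = k} := by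
        refine lintegral_congr fun s => ?_
        rw [Finset.sum_div, ENNReal.ofReal_sum_of_nonneg fun r _ => div_nonneg (ha r) hn'.le]
    _ = ENNReal.ofReal (k / n) * ENNReal.ofReal ((∑ r, a r) / n) := by
        rw [lintegral_sum_uniformOn_card_eq (by
            rw [Fintype.card_fin]; exact natAbs_imbalance_accepted_le hδ ω),
          ← ENNReal.ofReal_sum_of_nonneg fun r _ => div_nonneg (ha r) hn'.le, ← Finset.sum_div,
          Fintype.card_fin, ENNReal.ofReal_div_of_pos hn' (x := k), ENNReal.ofReal_natCast,
          ENNReal.ofReal_natCast]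
    _ = ENNReal.ofReal ((∑ r, a r) / n * (k / n)) := by
        rw [mul_comm, ENNReal.ofReal_mul haverage₀]
    _ ≤ ENNReal.ofReal (C * (n : ℝ) ^ (-δ)) :=
        ENNReal.ofReal_le_ofReal (by gcongr; exact haverage₀.trans haverage)

/-- At most `n ^ (1 - δ)` of the `n` nodes are selected, and they are selected at random, so their
share of `∑ f` is on average at most `n ^ (-δ) * ∑ f`. -/
lemma withHighProbability_selected_sum_le (hδ : 0 ≤ δ)
    (haccept : WithHighProbability (iidLaw G) fun _ x => Accept δ x) {f : ℕ × ℕ → ℝ}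
    (hf : ∀ p, 0 ≤ f p) (hint : Integrable f G) {η : ℝ} (hηδ : η < δ) :
    WithHighProbability (algorithmLaw G δ) fun n ω =>
      (∑ r ∈ ω.2, f (accepted δ ω.1 r)) / n ≤ (n : ℝ) ^ (-η) := by
  obtain ⟨C, hC⟩ := exists_gt (∫ p, f p ∂G)
  have htotal := withHighProbability_accepted hδ haccept
    (withHighProbability_sum_le_mul .of_discrete hint hC)
  classical
  let F (n : ℕ) (z : (Fin n → ℕ × ℕ) × Finset (Fin n)) : ℝ≥0∞ :=
    if ∑ r, f (z.1 r) ≤ C * n then ENNReal.ofReal ((∑ r ∈ z.2, f (z.1 r)) / n) else 0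
  have hmeas (n : ℕ) : Measurable fun ω : Rounds n × Finset (Fin n) =>
      F n (accepted δ ω.1, ω.2) :=
    (Measurable.of_discrete (f := F n)).comp (measurable_accepted_prodMk δ n)
  have hmean : ∀ᶠ n : ℕ in atTop, ∫⁻ ω, F n (accepted δ ω.1, ω.2) ∂algorithmLaw G δ n ≤
      ENNReal.ofReal (C * (n : ℝ) ^ (-δ)) := by
    filter_upwards [eventually_gt_atTop 0] with n hn
    have := isMarkovKernel_selection hδ n
    rw [algorithmLaw, Measure.lintegral_compProd (hmeas n)]
    refine (lintegral_mono fun ω => ?_).trans_eq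
      ((lintegral_const (ENNReal.ofReal (C * (n : ℝ) ^ (-δ)))).trans
        (by rw [measure_univ, mul_one]))
    by_cases h : ∑ r, f (accepted δ ω r) ≤ C * n
    · simpa only [F, h, if_true] using
        lintegral_selection_average_le hδ hn (fun r => hf _) h ω
    · simp [F, h]
  refine ((WithHighProbability.of_lintegral_le (fun n => (hmeas n).aemeasurable) hηδ hmean).and
    htotal).mono (Eventually.of_forall fun n => ae_of_all _ fun ω hω => ?_)
  have hle := hω.1
  simp only [F, hω.2.2, if_true] at hle
  exact (ENNReal.ofReal_le_ofReal_iff (by positivity)).1 hle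

end Algorithm

/-! ### The output of the algorithm -/

section Output

/-- The distance between the normalized empirical law of a sequence and its limit, for the values
`X` weighted by `W`. The laws `G^±` have weight `1`; `F^+` is the law of `𝒟⁺` weighted by `𝒟⁻`, and
`F^-` that of `𝒟⁻` weighted by `𝒟⁺`. -/
def lawDist (G : Measure (ℕ × ℕ)) (X W : ℕ × ℕ → ℕ) {n : ℕ} (d : Fin n → ℕ × ℕ) : ℝ≥0∞ :=
  d₁ (normalizedLaw (empiricalLaw X W d)) (normalizedLaw (weightedLaw G X W))

variable {G : Measure (ℕ × ℕ)} [IsProbabilityMeasure G] {δ κ : ℝ}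

lemma withHighProbability_lawDist_output_le (hδ : 0 ≤ δ)
    (haccept : WithHighProbability (iidLaw G) fun _ x => Accept δ x) (hκ₀ : 0 < κ) (hκ₁ : κ ≤ 1)
    (hG : Integrable (envelope (1 + κ)) G) (hδκ : δ < 1 - (1 + κ)⁻¹) {X W : ℕ × ℕ → ℕ}
    (hXW : IsAdmissible X W) (hW : 0 < ∫ p, (W p : ℝ) ∂G) {ε : ℝ} (hε : 0 ≤ ε) (hεδ : ε < δ) :
    WithHighProbability (algorithmLaw G δ) fun n ω =>
      lawDist G X W (output δ ω) ≤ ENNReal.ofReal ((n : ℝ) ^ (-ε)) := by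
  have hq : 1 ≤ 1 + κ := by linarith
  obtain ⟨η, hεη, hηδ⟩ := exists_between hεδ
  have hmass : weightedLaw G X W Set.univ = ENNReal.ofReal (∫ p, (W p : ℝ) ∂G) :=
    weightedLaw_univ .of_discrete (hXW.integrable_weight hq hG)
  have : IsFiniteMeasure (weightedLaw G X W) := ⟨by rw [hmass]; exact ENNReal.ofReal_lt_top⟩
  have : NeZero (weightedLaw G X W) :=
    ⟨fun h => hW.not_ge (ENNReal.ofReal_eq_zero.1 (hmass.symm.trans (by simp [h])))⟩
  have hmean : ∑' t, weightedLaw G X W (Set.Ici t) ≠ ∞ := by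
    rw [tsum_weightedLaw_Ici .of_discrete .of_discrete]
    exact (hXW.integrable hq hG).lintegral_lt_top.ne
  have hsample := withHighProbability_accepted hδ haccept <|
    withHighProbability_tailDist_empiricalLaw_le .of_discrete .of_discrete (by linarith)
      (by linarith) (hXW.integrable_rpow (by linarith) hG) (hηδ.trans hδκ)
  have hselected := withHighProbability_selected_sum_le hδ haccept (envelope_nonneg (1 + κ)) hG hηδ
  set c : ℝ := 2 * 4 ^ (1 + κ)
  refine (hsample.and hselected).mono ?_
  filter_upwards [eventually_d₁_normalizedLaw_le hmean (C := c + 1) (by positivity)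
    (hε.trans_lt hεη) hεη] with n hn
  refine ae_of_all _ fun ω ⟨⟨_, hsampleω⟩, hselectedω⟩ => hn _ inferInstance ?_
  calc tailDist (empiricalLaw X W (output δ ω)) (weightedLaw G X W)
      ≤ tailDist (empiricalLaw X W (output δ ω)) (empiricalLaw X W (accepted δ ω.1)) +
          tailDist (empiricalLaw X W (accepted δ ω.1)) (weightedLaw G X W) :=
        tailDist_triangle _ _ _
    _ ≤ ENNReal.ofReal (c * (n : ℝ) ^ (-η)) + ENNReal.ofReal ((n : ℝ) ^ (-η)) := by
        gcongr
        exact (tailDist_corrected_le hXW hq).trans (ENNReal.ofReal_le_ofReal (by gcongr))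
    _ = ENNReal.ofReal ((c + 1) * (n : ℝ) ^ (-η)) := by
        rw [← ENNReal.ofReal_add (by positivity) (by positivity), add_one_mul]

lemma withHighProbability_sum_momentTerm_output_le (hδ : 0 < δ)
    (haccept : WithHighProbability (iidLaw G) fun _ x => Accept δ x) (hκ : 0 ≤ κ)
    (hG : Integrable (envelope (1 + κ)) G) {K : ℝ} (hK : ∫ p, momentTerm κ p ∂G < K) :
    WithHighProbability (algorithmLaw G δ) fun n ω =>
      ∑ r, momentTerm κ (output δ ω r) ≤ K * n := by
  obtain ⟨a, ha, haK⟩ := exists_between hK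
  obtain ⟨η, hη, hηδ⟩ := exists_between hδ
  have hsample := withHighProbability_accepted hδ.le haccept <|
    withHighProbability_sum_le_mul .of_discrete (integrable_momentTerm hκ hG) ha
  have hselected :=
    withHighProbability_selected_sum_le hδ.le haccept (envelope_nonneg (1 + κ)) hG hηδ
  set c : ℝ := 2 * 4 ^ (1 + κ)
  have hsmall : Tendsto (fun n : ℕ => c * (n : ℝ) ^ (-η)) atTop (𝓝 0) := by
    simpa using ((tendsto_rpow_neg_atTop hη).comp tendsto_natCast_atTop_atTop).const_mul c
  refine (hsample.and hselected).mono ?_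
  filter_upwards [hsmall.eventually_le_const (sub_pos.2 haK), eventually_gt_atTop 0] with n hn hn₀
  refine ae_of_all _ fun ω ⟨⟨_, hsampleω⟩, hselectedω⟩ => ?_
  rw [div_le_iff₀ (Nat.cast_pos.2 hn₀)] at hselectedω
  calc ∑ r, momentTerm κ (output δ ω r)
      ≤ ∑ r, momentTerm κ (accepted δ ω.1 r) +
          c * ∑ r ∈ ω.2, envelope (1 + κ) (accepted δ ω.1 r) := sum_momentTerm_corrected_le hκ
    _ ≤ a * n + c * ((n : ℝ) ^ (-η) * n) := by gcongr
    _ = (a + c * (n : ℝ) ^ (-η)) * n := by ring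
    _ ≤ K * n := by gcongr; linarith

lemma isRegular_iff {ε K : ℝ} (hfst : Integrable (fun p : ℕ × ℕ => (p.1 : ℝ)) G)
    (hsnd : Integrable (fun p : ℕ × ℕ => (p.2 : ℝ)) G)
    (hmean : ∫ p, (p.1 : ℝ) ∂G = ∫ p, (p.2 : ℝ) ∂G) (hpos : 0 < ∫ p, (p.2 : ℝ) ∂G) {n : ℕ}
    {d : Fin n → ℕ × ℕ} :
    IsRegular G κ ε K d ↔ ∑ r, (d r).1 = ∑ r, (d r).2 ∧
      lawDist G Prod.snd (fun _ => 1) d ≤ ENNReal.ofReal ((n : ℝ) ^ (-ε)) ∧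
      lawDist G Prod.fst (fun _ => 1) d ≤ ENNReal.ofReal ((n : ℝ) ^ (-ε)) ∧
      lawDist G Prod.snd Prod.fst d ≤ ENNReal.ofReal ((n : ℝ) ^ (-ε)) ∧
      lawDist G Prod.fst Prod.snd d ≤ ENNReal.ofReal ((n : ℝ) ^ (-ε)) ∧
      ∑ r, momentTerm κ (d r) ≤ K * n := by
  refine and_congr_right fun hd => ?_
  rw [ofMass_gMinus, ofMass_gPlus, ofMass_fPlus, ofMass_fMinus hd, limGMinus_eq, limGPlus_eq,
    limFMinus_eq hsnd hpos, limFPlus_eq hfst hmean hpos]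
  rfl

end Output

end IIDAlgorithm

end

open IIDAlgorithm in
theorem theorem3p1 (G : Measure (ℕ × ℕ)) [IsProbabilityMeasure G]
    (κ δ ε K : ℝ) (hκ₀ : 0 < κ) (hκ₁ : κ ≤ 1)
    (hmean : ∫ p, (p.1 : ℝ) ∂G = ∫ p, (p.2 : ℝ) ∂G)
    (hν : 0 < ∫ p, (p.2 : ℝ) ∂G)
    (hdiff : Integrable (fun p : ℕ × ℕ => |(p.1 : ℝ) - (p.2 : ℝ)| ^ (1 + κ)) G)
    (hprod : Integrable (fun p : ℕ × ℕ => (p.1 : ℝ) ^ (1 + κ) * (p.2 : ℝ) ^ (1 + κ)) G)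
    (hδ : (κ < 1 ∧ ∃ c : ℝ, 0 < c ∧ c < 1 ∧ δ = c * κ / (1 + κ)) ∨
      (κ = 1 ∧ 0 < δ ∧ δ < 1 / 2))
    (hε₀ : 0 < ε) (hεδ : ε < δ)
    (hK : ∫ p, ((p.1 : ℝ) ^ (1 + κ) * (p.2 : ℝ) + (p.1 : ℝ) * (p.2 : ℝ) ^ (1 + κ)) ∂G < K) :
    Tendsto
      (fun n : ℕ => IIDAlgorithm.algorithmLaw G δ n (IIDAlgorithm.regularEvent G δ κ ε K n))
      atTop (𝓝 1) := by
  have hδ₀ : 0 < δ := hε₀.trans hεδ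
  have hδκ : δ < 1 - (1 + κ)⁻¹ := by
    rw [show 1 - (1 + κ)⁻¹ = κ / (1 + κ) by field_simp; ring]
    rcases hδ with ⟨-, c, -, hc, rfl⟩ | ⟨rfl, -, hδ⟩
    · gcongr; exact mul_lt_of_lt_one_left hκ₀ hc
    · norm_num; linarith
  have hG : Integrable (envelope (1 + κ)) G := integrable_envelope (by linarith) hdiff hprod
  have hfst := isAdmissible_snd_fst.integrable_weight (by linarith) hG
  have hsnd := isAdmissible_fst_snd.integrable_weight (by linarith) hG
  have haccept : WithHighProbability (iidLaw G) fun _ x => Accept δ x :=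
    withHighProbability_accept (by linarith) (by linarith) hdiff
      (by rw [integral_sub hfst hsnd, hmean, sub_self]) hδκ
  have hdist {X W : ℕ × ℕ → ℕ} (hXW : IsAdmissible X W) (hW : 0 < ∫ p, (W p : ℝ) ∂G) :=
    withHighProbability_lawDist_output_le hδ₀.le haccept hκ₀ hκ₁ hG hδκ hXW hW hε₀.le hεδ
  have hmoment := withHighProbability_sum_momentTerm_output_le hδ₀ haccept hκ₀.le hG (K := K)
    (by simpa only [momentTerm_eq hκ₀] using hK)
  have := isProbabilityMeasure_algorithmLaw (G := G) hδ₀.le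
  refine (((withHighProbability_accepted hδ₀.le haccept haccept).and <|
    (hdist isAdmissible_snd_one (by simp)).and <| (hdist isAdmissible_fst_one (by simp)).and <|
    (hdist isAdmissible_snd_fst (hmean ▸ hν)).and <| (hdist isAdmissible_fst_snd hν).and
    hmoment).mono <| Eventually.of_forall fun n => ?_).tendsto_measure
  filter_upwards [ae_card_selected_eq hδ₀.le n] with ω hcard ⟨⟨hT, _⟩, hreg⟩
  exact ⟨hT, (isRegular_iff hfst hsnd hmean hν).2 ⟨sum_corrected_eq hcard, hreg⟩⟩
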